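/- Let $U,X,Y,Z$ be complex Hilbert spaces and $W=\mathbb C^q$, $q\in\mathbb N$. A triple $(\mathcal B,\mathcal A,\mathcal C)$ of linear operators $\mathcal A:D(\mathcal A)\subset X\to X$, $\mathcal B:D(\mathcal B)\subset X\to U$, $\mathcal C:D(\mathcal C)\subset X\to Y$ with $D(\mathcal A)\subset D(\mathcal B)\cap D(\mathcal C)$ is called a boundary control system (BCS) on $(U,X,Y)$ if $\mathcal A|_{D(\mathcal A)\cap\ker\mathcal B}$ generates a $C_0$-semigroup on $X$ and there is $B\in\mathcal L(U,X)$ with $BU\subset D(\mathcal A)$, $\mathcal AB\in\mathcal L(U,X)$, $\mathcal BB=I_U$ and $\mathcal CB\in\mathcal L(U,Y)$. An operator $C\in\mathcal L(D(A),Y)$ (graph norm on $D(A)$) is an admissible observation operator for a $C_0$-semigroup $\mathbb T$ on $X$ with generator $A$ if for some $\tau>0$ and $K\ge0$ one has $\int_0^\tau\|C\,\mathbb T(t)x\|^2\,dt\le K^2\|x\|^2$ for all $x\in D(A)$. Let $\mathcal A,\mathcal B,\mathcal C$ be linear operators as above with $D(\mathcal A)\subset D(\mathcal B)\cap D(\mathcal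 C)$, and let $R_1,R_2\in\mathcal L(U)$, $\mathcal G_1\in\mathcal L(Z)$, $\mathcal G_2\in\mathcal L(Y,Z)$, $K\in\mathcal L(Z,U)$, $Q\in\mathcal L(Y,U)$, $E\in\mathcal L(W,U)$, $F\in\mathcal L(W,Y)$ and $S=\operatorname{diag}(i\omega_1,\dots,i\omega_q)$ with distinct $\omega_k\in\mathbb R$. They form the plant $\dot x=\mathcal Ax$, $\mathcal Bx=R_1u+R_2w$, $y=\mathcal Cx$, the controller $\dot z=\mathcal G_1z+\mathcal G_2(y-y_{ref})$, $u=Kz-Q(y-y_{ref})$ and the exosystem $\dot v=Sv$, $w=Ev$, $y_{ref}=-Fv$. Assume that $R_1Q$ is an admissible feedback operator, i.e. that $(\mathcal B+R_1Q\mathcal C,\mathcal A,\mathcal C)$ is a BCS on $(U,X,Y)$, and that $\mathcal C$ is an admissible observation operator for the semigroup generated by $A_s:=\mathcal A|_{D(\mathcal A)\cap\ker(\mathcal B+R_1Q\mathcal C)}$. Let $B_s\in\mathcal L(U,X)$ be any right inverse of $\mathcal B+R_1Q\mathcal C$ with $B_sU\subset D(\mathcal A)$, $\mathcal AB_s\in\mathcal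 L(U,X)$ and $\mathcal CB_s\in\mathcal L(U,Y)$. Put $E_s:=R_2E-R_1QF$, $\tilde{\mathcal G}_1:=\mathcal G_1+\mathcal G_2\mathcal CB_sR_1K$, $X_e:=X\times Z$ and $$A_e:=\begin{bmatrix}A_s-B_sR_1K\mathcal G_2\mathcal C&\mathcal AB_sR_1K-B_sR_1K\tilde{\mathcal G}_1\\ \mathcal G_2\mathcal C&\tilde{\mathcal G}_1\end{bmatrix},\qquad D(A_e):=D(A_s)\times Z,$$ $$B_e:=\begin{bmatrix}\mathcal AB_sE_s-B_sE_sS-B_sR_1K\mathcal G_2(\mathcal CB_sE_s+F)\\ \mathcal G_2(\mathcal CB_sE_s+F)\end{bmatrix},\quad C_e:=\begin{bmatrix}\mathcal C&\mathcal CB_sR_1K\end{bmatrix},\quad D(C_e):=D(\mathcal C)\times Z,\quad D_e:=\mathcal CB_sE_s+F,$$ and $P_e(\lambda):=C_e(\lambda-A_e)^{-1}B_e+D_e$ for $\lambda\in\rho(A_e)$. **Theorem.** The operator $A_e$ generates a $C_0$-semigroup $\mathbb T_e$ on $X_e$, and $C_e$ is an admissible observation operator for $\mathbb T_e$. The closed-loop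 system $\dot x_e=A_ex_e+B_ev$, $e=C_ex_e+D_ev$ with input $v$, state $x_e$ and output $e$ is well-posed: for every $x_0\in D(A_e)$ and $v\in C^1([0,\infty);W)$ it has a classical solution on $[0,\infty)$ with $x_e(0)=x_0$ (that is, $x_e\in C^1([0,\infty);X_e)$, $x_e(t)\in D(A_e)$ and both equations hold for all $t\ge0$), and for every $\tau>0$ there is $K_\tau\ge 0$ such that every classical solution with continuous input $v$ satisfies $$\|x_e(\tau)\|^2+\int_0^\tau\|e(t)\|^2\,dt\le K_\tau\Big(\|x_e(0)\|^2+\int_0^\tau\|v(t)\|^2\,dt\Big).$$ It is regular with feedthrough operator $D_e$, i.e. it is well-posed and $P_e(\lambda)v\to D_ev$ for all $v\in W$ as $\lambda\to+\infty$ in $\mathbb R$. Moreover, $\rho(A_e)$ contains a right half-plane, and $P_e(\lambda)\to D_e$ in $\mathcal L(W,Y)$ as $\operatorname{Re}\lambda\to\infty$. -/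

import Mathlib

open Set Filter Topology MeasureTheory

noncomputable section

namespace BoundaryControl

/-! ### Strongly continuous semigroups and unbounded operators -/

section Semigroups

variable {X Y : Type*} [NormedAddCommGroup X] [NormedSpace ℂ X]
  [NormedAddCommGroup Y] [NormedSpace ℂ Y]

/-- A `C₀`-semigroup of bounded operators on `X`. Only the values at times `t ≥ 0` matter. -/
structure C0Semigroup (X : Type*) [NormedAddCommGroup X] [NormedSpace ℂ X] where
  op : ℝ → X →L[ℂ] X
  op_zero : op 0 = ContinuousLinearMap.id ℂ X
  op_add : ∀ s t : ℝ, 0 ≤ s → 0 ≤ t → op (s + t) = (op s).comp (op t)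
  continuousOn_orbit : ∀ x : X, ContinuousOn (fun t => op t x) (Ici 0)

/-- `A` is the infinitesimal generator of `T`: `x ∈ D(A)` with `A x = y` if and only if the
difference quotient `t⁻¹ (T(t) x - x)` converges to `y` as `t ↓ 0`. -/
def C0Semigroup.IsGenerator (T : C0Semigroup X) (A : X →ₗ.[ℂ] X) : Prop :=
  ∀ x y : X, (x, y) ∈ A.graph ↔
    Tendsto (fun t : ℝ => ((t⁻¹ : ℝ) : ℂ) • (T.op t x - x)) (𝓝[>] (0 : ℝ)) (𝓝 y)

/-- `C x` for `x` in the domain of `C`, and `0` elsewhere (it is only used inside the domain). -/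
def evalOn (C : X →ₗ.[ℂ] Y) (x : X) : Y :=
  open Classical in if h : x ∈ C.domain then C ⟨x, h⟩ else 0

theorem evalOn_of_mem (C : X →ₗ.[ℂ] Y) {x : X} (h : x ∈ C.domain) :
    evalOn C x = C ⟨x, h⟩ := by
  simp [evalOn, h]

/-- The semigroup leaves the domain of its generator invariant; hence in the definition of
admissibility below `evalOn C` is evaluated only on the domain of `C`. -/
theorem C0Semigroup.IsGenerator.op_mem {T : C0Semigroup X} {A : X →ₗ.[ℂ] X}
    (hT : T.IsGenerator A) {x : X} (hx : x ∈ A.domain) {t : ℝ} (ht : 0 ≤ t) :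
    T.op t x ∈ A.domain := by
  have h1 : (x, A ⟨x, hx⟩) ∈ A.graph := A.mem_graph ⟨x, hx⟩
  have h2 := (hT x _).1 h1
  have h3 := ((T.op t).continuous.tendsto (A ⟨x, hx⟩)).comp h2
  refine LinearPMap.mem_domain_of_mem_graph ((hT _ (T.op t (A ⟨x, hx⟩))).2 (h3.congr' ?_))
  filter_upwards [self_mem_nhdsWithin] with s hs
  have hs' : (0 : ℝ) ≤ s := le_of_lt hs
  have e : T.op s (T.op t x) = T.op t (T.op s x) := by
    have a := T.op_add s t hs' ht
    have b := T.op_add t s ht hs'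
    rw [add_comm] at b
    rw [a] at b
    exact congrArg (fun L : X →L[ℂ] X => L x) b
  simp [e]

/-- `C` is an admissible observation operator for the semigroup `T` with generator `A`:
`C ∈ L(D(A), Y)` for the graph norm on `D(A)`, and there are `τ > 0` and `K ≥ 0` with
`∫₀^τ ‖C T(t) x‖² dt ≤ K² ‖x‖²` for all `x ∈ D(A)`. -/
structure IsAdmissibleObservation (T : C0Semigroup X) (A : X →ₗ.[ℂ] X) (C : X →ₗ.[ℂ] Y) :
    Prop where
  domain_le : A.domain ≤ C.domain
  bounded : ∃ M : ℝ, ∀ (x : X) (hx : x ∈ A.domain),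
    ‖C ⟨x, domain_le hx⟩‖ ≤ M * (‖x‖ + ‖A ⟨x, hx⟩‖)
  estimate : ∃ τ : ℝ, 0 < τ ∧ ∃ K : ℝ, 0 ≤ K ∧ ∀ x ∈ A.domain,
    ∫⁻ t in Icc 0 τ, ‖evalOn C (T.op t x)‖ₑ ^ 2 ≤ ENNReal.ofReal (K ^ 2 * ‖x‖ ^ 2)

/-- The linear map `lam - A : D(A) → X`. -/
def shifted (A : X →ₗ.[ℂ] X) (lam : ℂ) : A.domain →ₗ[ℂ] X :=
  lam • A.domain.subtype - A.toFun

/-- `lam ∈ ρ(A)`: the map `lam - A : D(A) → X` is bijective and its inverse is bounded. -/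
def InResolventSet (A : X →ₗ.[ℂ] X) (lam : ℂ) : Prop :=
  Function.Bijective (shifted A lam) ∧
    ∃ M : ℝ, ∀ x : A.domain, ‖(x : X)‖ ≤ M * ‖shifted A lam x‖

/-- The resolvent `(lam - A)⁻¹ : X → D(A)` (set to `0` if `lam - A` is not bijective). -/
def resolventMap (A : X →ₗ.[ℂ] X) (lam : ℂ) : X →ₗ[ℂ] A.domain :=
  open Classical in
  if h : Function.Bijective (shifted A lam) then
    ((LinearEquiv.ofBijective (shifted A lam) h).symm : X →ₗ[ℂ] A.domain)
  else 0

end Semigroups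

/-! ### Input/state/output systems with a bounded control operator -/

section Systems

/-- The system `x' = A x + B v`, `e = C x + D v` with input space `W`, state space `X` and output
space `Y`, with bounded `B` and `D` and unbounded `A` and `C`, `D(A) ⊆ D(C)`. -/
structure StateSystem (W X Y : Type*) [NormedAddCommGroup W] [NormedSpace ℂ W]
    [NormedAddCommGroup X] [NormedSpace ℂ X] [NormedAddCommGroup Y] [NormedSpace ℂ Y] where
  A : X →ₗ.[ℂ] X
  B : W →L[ℂ] X
  C : X →ₗ.[ℂ] Y
  D : W →L[ℂ] Y
  domain_le : A.domain ≤ C.domain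

variable {W X Y : Type*} [NormedAddCommGroup W] [NormedSpace ℂ W]
    [NormedAddCommGroup X] [NormedSpace ℂ X] [NormedAddCommGroup Y] [NormedSpace ℂ Y]

namespace StateSystem

/-- The transfer function `P(lam) = C (lam - A)⁻¹ B + D`, for `lam ∈ ρ(A)`. -/
def transferFunction (S : StateSystem W X Y) (lam : ℂ) : W →ₗ[ℂ] Y :=
  (S.C.toFun ∘ₗ Submodule.inclusion S.domain_le) ∘ₗ resolventMap S.A lam ∘ₗ
    (S.B : W →ₗ[ℂ] X) + (S.D : W →ₗ[ℂ] Y)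

/-- `(v, x, e)` is a classical input/state/output trajectory on `[0, ∞)`: `v` is continuous, `x` is
continuously differentiable, `x(t) ∈ D(A)`, `x'(t) = A x(t) + B v(t)` and
`e(t) = C x(t) + D v(t)` for all `t ≥ 0`. -/
structure IsClassicalTrajectory (S : StateSystem W X Y) (v : ℝ → W) (x : ℝ → X) (e : ℝ → Y) :
    Prop where
  continuousOn_input : ContinuousOn v (Ici 0)
  contDiffOn_state : ContDiffOn ℝ 1 x (Ici 0)
  mem_domain : ∀ t, 0 ≤ t → x t ∈ S.A.domain
  state_eq : ∀ (t : ℝ) (ht : 0 ≤ t),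
    derivWithin x (Ici 0) t = S.A ⟨x t, mem_domain t ht⟩ + S.B (v t)
  output_eq : ∀ (t : ℝ) (ht : 0 ≤ t),
    e t = S.C ⟨x t, S.domain_le (mem_domain t ht)⟩ + S.D (v t)

/-- Well-posedness (in the `L²` sense): `A` generates a `C₀`-semigroup, `C` is bounded for the
graph norm of `A`, there is a classical trajectory for every initial state in `D(A)` and every
continuously differentiable input, and on each interval `[0, τ]` the final state and the
output in `L²` of every classical trajectory depend boundedly on the initial state and the
input in `L²`. -/
structure IsWellPosed (S : StateSystem W X Y) : Prop where
  generates : ∃ T : C0Semigroup X, T.IsGenerator S.A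
  bounded_observation : ∃ M : ℝ, ∀ x : S.A.domain,
    ‖S.C ⟨x, S.domain_le x.2⟩‖ ≤ M * (‖(x : X)‖ + ‖S.A x‖)
  exists_trajectory : ∀ x₀ ∈ S.A.domain, ∀ v : ℝ → W, ContDiffOn ℝ 1 v (Ici 0) →
    ∃ (x : ℝ → X) (e : ℝ → Y), S.IsClassicalTrajectory v x e ∧ x 0 = x₀
  estimate : ∀ τ : ℝ, 0 < τ → ∃ K : NNReal, ∀ (v : ℝ → W) (x : ℝ → X) (e : ℝ → Y),
    S.IsClassicalTrajectory v x e →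
      ‖x τ‖ₑ ^ 2 + ∫⁻ t in Icc 0 τ, ‖e t‖ₑ ^ 2 ≤
        (K : ENNReal) * (‖x 0‖ₑ ^ 2 + ∫⁻ t in Icc 0 τ, ‖v t‖ₑ ^ 2)

/-- A well-posed system is regular with feedthrough operator `D₀` if its transfer function
satisfies `P(lam) v → D₀ v` as `lam → +∞` along the real axis, for every input vector `v`. -/
structure IsRegularWith (S : StateSystem W X Y) (D₀ : W →L[ℂ] Y) : Prop where
  wellPosed : S.IsWellPosed
  mem_resolventSet : ∀ᶠ lam : ℝ in atTop, InResolventSet S.A (lam : ℂ)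
  tendsto : ∀ v : W,
    Tendsto (fun lam : ℝ => S.transferFunction (lam : ℂ) v) atTop (𝓝 (D₀ v))

end StateSystem

end Systems

/-! ### Boundary control systems -/

section BCS

variable {U X Y : Type*} [NormedAddCommGroup U] [InnerProductSpace ℂ U]
  [NormedAddCommGroup X] [InnerProductSpace ℂ X] [NormedAddCommGroup Y] [InnerProductSpace ℂ Y]

/-- The restriction of `𝒜` to `D(𝒜) ∩ ker ℬ`. -/
def kerRestrict (ℬ : X →ₗ.[ℂ] U) (𝒜 : X →ₗ.[ℂ] X) : X →ₗ.[ℂ] X :=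
  𝒜.domRestrict ((LinearMap.ker ℬ.toFun).map ℬ.domain.subtype)

/-- An operator `B ∈ L(U, X)` with `B U ⊆ D(𝒜)`, `𝒜 B ∈ L(U, X)`, `ℬ B = I` and
`𝒞 B ∈ L(U, Y)`. The fields `AB` and `CB` are the bounded operators `𝒜 B` and `𝒞 B`. -/
structure BCSRightInverse (ℬ : X →ₗ.[ℂ] U) (𝒜 : X →ₗ.[ℂ] X) (𝒞 : X →ₗ.[ℂ] Y) where
  B : U →L[ℂ] X
  AB : U →L[ℂ] X
  CB : U →L[ℂ] Y
  graph_A : ∀ u : U, (B u, AB u) ∈ 𝒜.graph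
  graph_B : ∀ u : U, (B u, u) ∈ ℬ.graph
  graph_C : ∀ u : U, (B u, CB u) ∈ 𝒞.graph

/-- `(ℬ, 𝒜, 𝒞)` is a boundary control system on `(U, X, Y)`. -/
structure IsBCS (ℬ : X →ₗ.[ℂ] U) (𝒜 : X →ₗ.[ℂ] X) (𝒞 : X →ₗ.[ℂ] Y) : Prop where
  domain_le_B : 𝒜.domain ≤ ℬ.domain
  domain_le_C : 𝒜.domain ≤ 𝒞.domain
  generates : ∃ T : C0Semigroup X, T.IsGenerator (kerRestrict ℬ 𝒜)
  rightInverse : Nonempty (BCSRightInverse ℬ 𝒜 𝒞)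

/-- The operator `ℬ + N 𝒞`, with domain `D(ℬ) ∩ D(𝒞)`. -/
def feedback (ℬ : X →ₗ.[ℂ] U) (𝒞 : X →ₗ.[ℂ] Y) (N : Y →L[ℂ] U) : X →ₗ.[ℂ] U :=
  ℬ + (N : Y →ₗ[ℂ] U).compPMap 𝒞

/-- `N` is an admissible static output feedback operator for `(ℬ, 𝒜, 𝒞)`. -/
def IsAdmissibleFeedback (ℬ : X →ₗ.[ℂ] U) (𝒜 : X →ₗ.[ℂ] X) (𝒞 : X →ₗ.[ℂ] Y) (N : Y →L[ℂ] U) :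
    Prop :=
  IsBCS (feedback ℬ 𝒞 N) 𝒜 𝒞

end BCS

/-! ### The closed-loop system -/

/-- The plant `x' = 𝒜 x`, `ℬ x = R₁ u + R₂ w`, `y = 𝒞 x`, the controller
`z' = 𝒢₁ z + 𝒢₂ (y - y_ref)`, `u = K z - Q (y - y_ref)`, and the exosystem `v' = S v`,
`w = E v`, `y_ref = -F v` on `ℂ^q`, where `S = diag(i ω₁, …, i ω_q)` with distinct real `ω_k`. -/
structure ControlLoop (U X Y Z : Type*) (q : ℕ)
    [NormedAddCommGroup U] [InnerProductSpace ℂ U] [NormedAddCommGroup X] [InnerProductSpace ℂ X]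
    [NormedAddCommGroup Y] [InnerProductSpace ℂ Y]
    [NormedAddCommGroup Z] [InnerProductSpace ℂ Z] where
  𝒜 : X →ₗ.[ℂ] X
  ℬ : X →ₗ.[ℂ] U
  𝒞 : X →ₗ.[ℂ] Y
  domain_le_B : 𝒜.domain ≤ ℬ.domain
  domain_le_C : 𝒜.domain ≤ 𝒞.domain
  R₁ : U →L[ℂ] U
  R₂ : U →L[ℂ] U
  𝒢₁ : Z →L[ℂ] Z
  𝒢₂ : Y →L[ℂ] Z
  K : Z →L[ℂ] U
  Q : Y →L[ℂ] U
  ω : Fin q → ℝ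
  ω_injective : Function.Injective ω
  E : EuclideanSpace ℂ (Fin q) →L[ℂ] U
  F : EuclideanSpace ℂ (Fin q) →L[ℂ] Y

namespace ControlLoop

variable {U X Y Z : Type*} {q : ℕ}
    [NormedAddCommGroup U] [InnerProductSpace ℂ U] [NormedAddCommGroup X] [InnerProductSpace ℂ X]
    [NormedAddCommGroup Y] [InnerProductSpace ℂ Y] [NormedAddCommGroup Z] [InnerProductSpace ℂ Z]

/-- `S = diag(i ω₁, …, i ω_q)`. -/
def S (P : ControlLoop U X Y Z q) : EuclideanSpace ℂ (Fin q) →L[ℂ] EuclideanSpace ℂ (Fin q) :=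
  Matrix.toEuclideanCLM (𝕜 := ℂ) (Matrix.diagonal fun k => Complex.I * (P.ω k : ℂ))

/-- The boundary operator `ℬ + R₁ Q 𝒞` of the pre-stabilized plant. -/
def Bcl (P : ControlLoop U X Y Z q) : X →ₗ.[ℂ] U :=
  feedback P.ℬ P.𝒞 (P.R₁ ∘L P.Q)

/-- `A_s`, the restriction of `𝒜` to `D(𝒜) ∩ ker (ℬ + R₁ Q 𝒞)`. -/
def As (P : ControlLoop U X Y Z q) : X →ₗ.[ℂ] X :=
  kerRestrict P.Bcl P.𝒜

theorem domain_As_le (P : ControlLoop U X Y Z q) : P.As.domain ≤ P.𝒞.domain :=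
  inf_le_right.trans P.domain_le_C

/-- `E_s = R₂ E - R₁ Q F`. -/
def Es (P : ControlLoop U X Y Z q) : EuclideanSpace ℂ (Fin q) →L[ℂ] U :=
  P.R₂ ∘L P.E - P.R₁ ∘L P.Q ∘L P.F

/-- The right inverses `B_s` of `ℬ + R₁ Q 𝒞`. -/
abbrev RightInverse (P : ControlLoop U X Y Z q) : Type _ :=
  BCSRightInverse P.Bcl P.𝒜 P.𝒞

variable (P : ControlLoop U X Y Z q) (Bs : P.RightInverse)

/-- `B_s R₁ K`. -/
def BRK : Z →L[ℂ] X := Bs.B ∘L P.R₁ ∘L P.K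

/-- `𝒜 B_s R₁ K`. -/
def ABRK : Z →L[ℂ] X := Bs.AB ∘L P.R₁ ∘L P.K

/-- `𝒞 B_s R₁ K`. -/
def CBRK : Z →L[ℂ] Y := Bs.CB ∘L P.R₁ ∘L P.K

/-- `𝒢₁ + 𝒢₂ 𝒞 B_s R₁ K`. -/
def G₁tilde : Z →L[ℂ] Z := P.𝒢₁ + P.𝒢₂ ∘L P.CBRK Bs

/-- `D_e = 𝒞 B_s E_s + F`. -/
def De : EuclideanSpace ℂ (Fin q) →L[ℂ] Y := Bs.CB ∘L P.Es + P.F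

/-- The operator `A_e` on the Hilbert space `X × Z`, with domain `D(A_s) × Z`: it maps `(x, z)` to
`(A_s x - B_s R₁ K 𝒢₂ 𝒞 x + (𝒜 B_s R₁ K - B_s R₁ K 𝒢₁~) z, 𝒢₂ 𝒞 x + 𝒢₁~ z)`, where
`𝒢₁~ = 𝒢₁ + 𝒢₂ 𝒞 B_s R₁ K`. -/
def Ae : WithLp 2 (X × Z) →ₗ.[ℂ] WithLp 2 (X × Z) where
  domain := (P.As.domain.prod ⊤).comap (WithLp.linearEquiv 2 ℂ (X × Z)).toLinearMap
  toFun :=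
    { toFun := fun p => WithLp.toLp 2
        (P.As ⟨(p : WithLp 2 (X × Z)).fst, p.2.1⟩
            - P.BRK Bs (P.𝒢₂ (P.𝒞 ⟨(p : WithLp 2 (X × Z)).fst, P.domain_As_le p.2.1⟩))
            + (P.ABRK Bs - P.BRK Bs ∘L P.G₁tilde Bs) (p : WithLp 2 (X × Z)).snd,
          P.𝒢₂ (P.𝒞 ⟨(p : WithLp 2 (X × Z)).fst, P.domain_As_le p.2.1⟩)
            + P.G₁tilde Bs (p : WithLp 2 (X × Z)).snd)
      map_add' := by
        intro p r
        have h1 : P.As ⟨((p + r : _) : WithLp 2 (X × Z)).fst, (p + r).2.1⟩ =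
            P.As ⟨(p : WithLp 2 (X × Z)).fst, p.2.1⟩ +
              P.As ⟨(r : WithLp 2 (X × Z)).fst, r.2.1⟩ := by
          rw [← LinearPMap.map_add]; rfl
        have h2 : P.𝒞 ⟨((p + r : _) : WithLp 2 (X × Z)).fst, P.domain_As_le (p + r).2.1⟩ =
            P.𝒞 ⟨(p : WithLp 2 (X × Z)).fst, P.domain_As_le p.2.1⟩ +
              P.𝒞 ⟨(r : WithLp 2 (X × Z)).fst, P.domain_As_le r.2.1⟩ := by
          rw [← LinearPMap.map_add]; rfl
        rw [h1, h2, ← WithLp.toLp_add]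
        congr 1
        ext <;> simp <;> abel
      map_smul' := by
        intro c p
        have h1 : P.As ⟨((c • p : _) : WithLp 2 (X × Z)).fst, (c • p).2.1⟩ =
            c • P.As ⟨(p : WithLp 2 (X × Z)).fst, p.2.1⟩ := by
          rw [← LinearPMap.map_smul]; rfl
        have h2 : P.𝒞 ⟨((c • p : _) : WithLp 2 (X × Z)).fst, P.domain_As_le (c • p).2.1⟩ =
            c • P.𝒞 ⟨(p : WithLp 2 (X × Z)).fst, P.domain_As_le p.2.1⟩ := by
          rw [← LinearPMap.map_smul]; rfl
        rw [h1, h2, RingHom.id_apply, ← WithLp.toLp_smul]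
        congr 1
        ext <;> simp [smul_add, smul_sub] }

/-- The control operator `B_e`. -/
def Be : EuclideanSpace ℂ (Fin q) →L[ℂ] WithLp 2 (X × Z) :=
  ((WithLp.prodContinuousLinearEquiv 2 ℂ X Z).symm : X × Z →L[ℂ] WithLp 2 (X × Z)) ∘L
    (Bs.AB ∘L P.Es - Bs.B ∘L P.Es ∘L P.S - P.BRK Bs ∘L P.𝒢₂ ∘L P.De Bs).prod
      (P.𝒢₂ ∘L P.De Bs)

/-- The observation operator `C_e (x, z) = 𝒞 x + 𝒞 B_s R₁ K z`, with domain `D(𝒞) × Z`. -/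
def Ce : WithLp 2 (X × Z) →ₗ.[ℂ] Y where
  domain := (P.𝒞.domain.prod ⊤).comap (WithLp.linearEquiv 2 ℂ (X × Z)).toLinearMap
  toFun :=
    { toFun := fun p => P.𝒞 ⟨(p : WithLp 2 (X × Z)).fst, p.2.1⟩
        + P.CBRK Bs (p : WithLp 2 (X × Z)).snd
      map_add' := by
        intro p r
        have h2 : P.𝒞 ⟨((p + r : _) : WithLp 2 (X × Z)).fst, (p + r).2.1⟩ =
            P.𝒞 ⟨(p : WithLp 2 (X × Z)).fst, p.2.1⟩ +
              P.𝒞 ⟨(r : WithLp 2 (X × Z)).fst, r.2.1⟩ := by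
          rw [← LinearPMap.map_add]; rfl
        rw [h2]
        simp
        abel
      map_smul' := by
        intro c p
        have h2 : P.𝒞 ⟨((c • p : _) : WithLp 2 (X × Z)).fst, (c • p).2.1⟩ =
            c • P.𝒞 ⟨(p : WithLp 2 (X × Z)).fst, p.2.1⟩ := by
          rw [← LinearPMap.map_smul]; rfl
        rw [h2]
        simp [smul_add] }

/-- The closed-loop system `x_e' = A_e x_e + B_e v`, `e = C_e x_e + D_e v`. -/
def closedLoop : StateSystem (EuclideanSpace ℂ (Fin q)) (WithLp 2 (X × Z)) Y where
  A := P.Ae Bs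
  B := P.Be Bs
  C := P.Ce Bs
  D := P.De Bs
  domain_le := fun _ hp => ⟨P.domain_As_le hp.1, trivial⟩

end ControlLoop

end BoundaryControl

end

/-!
The theorem is a perturbation argument. On `X × Z` consider the semigroup `diag(T_s(t), I)` with
generator `diag(A_s, 0)`, and the observation `C' (x, z) = (𝒞 x, z)`, which is admissible for it
because `𝒞` is admissible for `T_s`. Everything in `A_e` besides `diag(A_s, 0)` is a bounded
operator applied to `C'`: there is a bounded `H : Y × Z → X × Z` with `A_e = diag(A_s, 0) + H C'`
(`ControlLoop.Ae_apply`), and `C_e` is `C'` followed by a bounded operator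
(`ControlLoop.evalOn_Ce`). So it suffices to show, for a generator `A` of `T`, an admissible `C`
and a bounded `H`, that `A + H C` is a generator, that `C` is admissible for its semigroup, and that
systems with a bounded control operator and an admissible observation operator are well-posed and
regular. All of this holds in Banach spaces.

*Resolvents.* If `‖exp(-lam τ) T(τ)‖ ≤ 1/2`, which holds for large `Re lam`, then
`(lam - A)⁻¹ = ∫₀^τ exp(-lam s) T(s) ds (1 - exp(-lam τ) T(τ))⁻¹`
(`C0Semigroup.exists_isResolvent`). With the Cauchy–Schwarz inequality, admissibility of `C` gives
`‖C (lam - A)⁻¹‖ = O(1 / √(Re lam))` (`AdmissibleOn.exists_resolvent_bound`). This is what makes the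
transfer function converge in norm to the feedthrough operator as `Re lam → ∞`.

*Generation.* The perturbed semigroup solves the Volterra equation
`S(t) x = T(t) x + ∫₀ᵗ S(t-r) H C T(r) x dr` for `x ∈ D(A)`. After rescaling by `exp(-ω t)` with a
large `ω`, admissibility bounds `∫₀ᵗ ‖H C T(r) x‖ dr` by `‖x‖ / 2` for all `t`, so the equation has a
unique solution by contraction (`exists_volterra`, `volterra_unique`); uniqueness also yields the
semigroup law (`exists_semigroup_of_volterra`). The generator of `S` extends `A + H C`, and the two
agree because `lam - A - H C = (1 - H C (lam - A)⁻¹) (lam - A)` is onto for large `lam`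
(`AdmissibleOn.exists_perturbation`).

*Convolutions.* Suppose `u(t) = ∫₀ᵗ T(t-r) f(r) dr` stays in `D(A)`. Then the `L²(0, σ)` norm of
`C u` is at most a constant times `√σ` times that of `f` (`AdmissibleOn.exists_lintegral_conv_le`).
For the approximations `lam C (lam - A)⁻¹` of `C` this follows from the Cauchy–Schwarz inequality
and Tonelli's theorem, and it passes to the limit by Fatou's lemma. By variation of constants
(`C0Semigroup.eq_flow_add_integral`) the estimate applies twice: to `C S(t) x - C T(t) x` on an
interval so short that the term can be absorbed, which gives admissibility of `C` for `S`
(`AdmissibleOn.of_perturbation`), and to the output of a classical trajectory, which gives the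
well-posedness estimate (`StateSystem.exists_trajectory_estimate`).

*Classical solutions.* For a continuously differentiable input the candidate derivative
`T(t) (A x₀ + f(0)) + ∫₀ᵗ T(t-r) f'(r) dr` is integrated; that the result lies in `D(A)` follows from
`C0Semigroup.hasGen_integral_conv`.
-/

open Set Filter Topology MeasureTheory

noncomputable section

namespace BoundaryControl

/-! ### Orbits of a semigroup and its generator -/

section Flow

variable {X Y : Type*} [NormedAddCommGroup X] [NormedSpace ℂ X]
  [NormedAddCommGroup Y] [NormedSpace ℂ Y]

namespace C0Semigroup

/-- The operators of a semigroup, extended to negative times by the identity. Unlike `T.op`, whose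
values at negative times are arbitrary, this is jointly continuous on all of `ℝ × X`. -/
def flow (T : C0Semigroup X) (t : ℝ) : X →L[ℂ] X := T.op (max t 0)

theorem flow_of_nonneg (T : C0Semigroup X) {t : ℝ} (ht : 0 ≤ t) : T.flow t = T.op t := by
  simp [flow, ht]

theorem flow_of_nonpos (T : C0Semigroup X) {t : ℝ} (ht : t ≤ 0) :
    T.flow t = ContinuousLinearMap.id ℂ X := by
  simp [flow, ht, T.op_zero]

@[simp] theorem flow_zero (T : C0Semigroup X) (x : X) : T.flow 0 x = x := by
  simp [flow, T.op_zero]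

theorem flow_add (T : C0Semigroup X) {s t : ℝ} (hs : 0 ≤ s) (ht : 0 ≤ t) (x : X) :
    T.flow (s + t) x = T.flow s (T.flow t x) := by
  simp [flow, hs, ht, add_nonneg hs ht, T.op_add s t hs ht]

theorem flow_comm (T : C0Semigroup X) {s t : ℝ} (hs : 0 ≤ s) (ht : 0 ≤ t) (x : X) :
    T.flow s (T.flow t x) = T.flow t (T.flow s x) := by
  rw [← T.flow_add hs ht, ← T.flow_add ht hs, add_comm]

theorem continuous_flow_apply (T : C0Semigroup X) (x : X) : Continuous fun t => T.flow t x :=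
  (T.continuousOn_orbit x).comp_continuous (by fun_prop : Continuous fun t : ℝ => max t 0)
    fun t => le_max_right t 0

/-- Local boundedness, by the uniform boundedness principle. -/
theorem exists_norm_flow_le [CompleteSpace X] (T : C0Semigroup X) (a : ℝ) :
    ∃ M : ℝ, 1 ≤ M ∧ ∀ t ≤ a, ‖T.flow t‖ ≤ M := by
  obtain ⟨M, hM⟩ := banach_steinhaus (g := fun t : Icc (0 : ℝ) (max a 0) => T.flow t) (by
    intro x
    obtain ⟨C, hC⟩ := (isCompact_Icc (a := (0 : ℝ)) (b := max a 0)).exists_bound_of_continuousOn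
      (T.continuous_flow_apply x).continuousOn
    exact ⟨C, fun t => hC t t.2⟩)
  refine ⟨max M 1, le_max_right _ _, fun t ht => le_max_of_le_left ?_⟩
  have := hM ⟨max t 0, le_max_right _ _, max_le_max_right 0 ht⟩
  simpa [flow] using this

theorem continuous_flow [CompleteSpace X] (T : C0Semigroup X) :
    Continuous fun p : ℝ × X => T.flow p.1 p.2 := by
  rw [continuous_iff_continuousAt]
  rintro ⟨t₀, x₀⟩
  obtain ⟨M, hM1, hM⟩ := T.exists_norm_flow_le (t₀ + 1)
  rw [ContinuousAt, tendsto_iff_norm_sub_tendsto_zero]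
  have h1 : Tendsto (fun p : ℝ × X => M * ‖p.2 - x₀‖ + ‖T.flow p.1 x₀ - T.flow t₀ x₀‖)
      (𝓝 (t₀, x₀)) (𝓝 0) := by
    have hc : Continuous fun p : ℝ × X =>
        M * ‖p.2 - x₀‖ + ‖T.flow p.1 x₀ - T.flow t₀ x₀‖ := by
      have := (T.continuous_flow_apply x₀).comp (continuous_fst (X := ℝ) (Y := X))
      simp only [Function.comp_def] at this
      fun_prop
    simpa using hc.tendsto (t₀, x₀)
  refine squeeze_zero' (Eventually.of_forall fun _ => norm_nonneg _) ?_ h1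
  have : ∀ᶠ p : ℝ × X in 𝓝 (t₀, x₀), p.1 < t₀ + 1 :=
    continuous_fst.continuousAt.eventually_lt_const (by simp)
  filter_upwards [this] with p hp
  calc ‖T.flow p.1 p.2 - T.flow t₀ x₀‖
      = ‖T.flow p.1 (p.2 - x₀) + (T.flow p.1 x₀ - T.flow t₀ x₀)‖ := by simp
    _ ≤ ‖T.flow p.1 (p.2 - x₀)‖ + ‖T.flow p.1 x₀ - T.flow t₀ x₀‖ := norm_add_le _ _
    _ ≤ _ := by gcongr; exact (T.flow p.1).le_of_opNorm_le (hM _ hp.le) _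

@[fun_prop]
theorem continuous_flow_comp [CompleteSpace X] (T : C0Semigroup X) {α : Type*} [TopologicalSpace α]
    {f : α → ℝ} {g : α → X} (hf : Continuous f) (hg : Continuous g) :
    Continuous fun a => T.flow (f a) (g a) :=
  T.continuous_flow.comp (hf.prodMk hg)

/-- `x` lies in the domain of the infinitesimal generator, and the generator maps it to `y`,
expressed as a right derivative of the orbit at `0`. -/
def HasGen (T : C0Semigroup X) (x y : X) : Prop :=
  HasDerivWithinAt (fun t => T.flow t x) y (Ioi 0) 0

theorem hasGen_iff_tendsto (T : C0Semigroup X) {x y : X} :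
    T.HasGen x y ↔
      Tendsto (fun t : ℝ => ((t⁻¹ : ℝ) : ℂ) • (T.op t x - x)) (𝓝[>] (0 : ℝ)) (𝓝 y) := by
  rw [HasGen, hasDerivWithinAt_iff_tendsto_slope' (by simp)]
  refine tendsto_congr' ?_
  filter_upwards [self_mem_nhdsWithin] with t ht
  simp [slope, T.flow_of_nonneg (le_of_lt ht)]
  rw [← Complex.ofReal_inv, Complex.coe_smul]

theorem IsGenerator.mem_graph_iff {T : C0Semigroup X} {A : X →ₗ.[ℂ] X} (hA : T.IsGenerator A)
    {x y : X} : (x, y) ∈ A.graph ↔ T.HasGen x y :=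
  (hA x y).trans T.hasGen_iff_tendsto.symm

theorem isGenerator_iff {T : C0Semigroup X} {A : X →ₗ.[ℂ] X} :
    T.IsGenerator A ↔ ∀ x y, (x, y) ∈ A.graph ↔ T.HasGen x y := by
  simp only [IsGenerator, hasGen_iff_tendsto]

theorem IsGenerator.hasGen {T : C0Semigroup X} {A : X →ₗ.[ℂ] X} (hA : T.IsGenerator A)
    (x : A.domain) : T.HasGen x (A x) :=
  hA.mem_graph_iff.1 (A.mem_graph x)

namespace HasGen

variable {T : C0Semigroup X} {x y x' y' : X}

theorem zero (T : C0Semigroup X) : T.HasGen 0 0 := by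
  simpa [HasGen] using hasDerivWithinAt_const (0 : ℝ) (Ioi (0 : ℝ)) (0 : X)

theorem add (h : T.HasGen x y) (h' : T.HasGen x' y') : T.HasGen (x + x') (y + y') := by
  simpa [HasGen] using HasDerivWithinAt.fun_add h h'

theorem sub (h : T.HasGen x y) (h' : T.HasGen x' y') : T.HasGen (x - x') (y - y') := by
  simpa [HasGen] using HasDerivWithinAt.fun_sub h h'

theorem smul (c : ℂ) (h : T.HasGen x y) : T.HasGen (c • x) (c • y) := by
  simpa [HasGen] using HasDerivWithinAt.fun_const_smul c h

theorem flow (h : T.HasGen x y) (t : ℝ) : T.HasGen (T.flow t x) (T.flow t y) := by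
  wlog ht : 0 ≤ t
  · rw [T.flow_of_nonpos (le_of_not_ge ht)]
    simpa using h
  have h1 := ((T.flow t).restrictScalars ℝ).hasFDerivAt.comp_hasDerivWithinAt (0 : ℝ) h
  refine HasDerivWithinAt.congr_of_eventuallyEq h1 ?_ (by simp)
  filter_upwards [self_mem_nhdsWithin] with s hs
  simp [T.flow_comm ht (le_of_lt hs)]

theorem hasDerivWithinAt (h : T.HasGen x y) {t : ℝ} (ht : 0 ≤ t) :
    HasDerivWithinAt (fun s => T.flow s x) (T.flow t y) (Ioi t) t := by
  have h1 : HasDerivWithinAt (fun s => T.flow s (T.flow t x)) (T.flow t y) (Ioi 0) (t - t) := by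
    rw [sub_self]; exact h.flow t
  have h2 := HasDerivWithinAt.scomp (h := fun s : ℝ => s - t) t h1
    ((hasDerivAt_id t).sub_const t).hasDerivWithinAt (s := Ioi t)
    (fun s hs => by simpa using hs)
  rw [one_smul] at h2
  refine HasDerivWithinAt.congr_of_eventuallyEq h2 ?_ (by simp)
  filter_upwards [self_mem_nhdsWithin] with s hs
  simp [← T.flow_add (sub_nonneg.2 (le_of_lt hs)) ht]

end HasGen

/-- Variation of constants. Only right derivatives are needed, and they are handled through the
identity `T(t-r) z(r) - T(t-s) z(s) = T(t-r) ((z(r) - z(s)) - (T(r-s) z(s) - z(s)))`. -/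
theorem eq_flow_add_integral [CompleteSpace X] (T : C0Semigroup X) {x x' y f : ℝ → X} {t : ℝ}
    (ht : 0 ≤ t) (hx : ContinuousOn x (Icc 0 t))
    (hx' : ∀ s ∈ Ico 0 t, HasDerivWithinAt x (x' s) (Ioi s) s)
    (hy : ∀ s ∈ Ico 0 t, T.HasGen (x s) (y s))
    (hf : Continuous f) (hfe : ∀ s ∈ Ico 0 t, f s = x' s - y s) :
    x t = T.flow t (x 0) + ∫ r in 0..t, T.flow (t - r) (f r) := by
  have hc : ContinuousOn (fun r => T.flow (t - r) (x r)) (Icc 0 t) :=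
    T.continuous_flow.comp_continuousOn
      ((by fun_prop : Continuous fun r : ℝ => t - r).continuousOn.prodMk hx)
  have hd : ∀ s ∈ Ioo 0 t, HasDerivWithinAt (fun r => T.flow (t - r) (x r))
      (T.flow (t - s) (f s)) (Ioi s) s := by
    intro s hs
    have hs' : s ∈ Ico 0 t := ⟨hs.1.le, hs.2⟩
    have h1 := (hasDerivWithinAt_iff_tendsto_slope' (by simp)).1 (hx' s hs')
    have h2 : Tendsto (fun r => slope (fun h => T.flow h (x s)) 0 (r - s)) (𝓝[>] s)
        (𝓝 (y s)) := by
      refine ((hasDerivWithinAt_iff_tendsto_slope' (by simp)).1 (hy s hs')).comp ?_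
      refine tendsto_nhdsWithin_iff.2 ⟨?_, ?_⟩
      · exact ((continuous_sub_right s).tendsto' s 0 (by simp)).mono_left nhdsWithin_le_nhds
      · filter_upwards [self_mem_nhdsWithin] with r hr
        simpa using hr
    have h3 : Tendsto (fun r => t - r) (𝓝[>] s) (𝓝 (t - s)) :=
      ((continuous_sub_left t).tendsto s).mono_left nhdsWithin_le_nhds
    have h4 := (T.continuous_flow.tendsto (t - s, f s)).comp
      (h3.prodMk_nhds ((hfe s hs') ▸ h1.sub h2))
    rw [hasDerivWithinAt_iff_tendsto_slope' (by simp)]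
    refine h4.congr' ?_
    filter_upwards [self_mem_nhdsWithin, nhdsWithin_le_nhds (Iio_mem_nhds hs.2)] with r hr hrt
    have hr' : 0 ≤ r - s := sub_nonneg.2 (le_of_lt hr)
    have e : T.flow (t - s) (x s) = T.flow (t - r) (T.flow (r - s) (x s)) := by
      rw [← T.flow_add (sub_nonneg.2 (le_of_lt hrt)) hr']; congr 2; ring
    have hsm : ∀ z, T.flow (t - r) ((r - s)⁻¹ • z) = (r - s)⁻¹ • T.flow (t - r) z :=
      fun z => ((T.flow (t - r)).restrictScalars ℝ).map_smul _ z
    simp only [Function.comp_def, slope, vsub_eq_sub, sub_zero, flow_zero, e, ← smul_sub,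
      hsm, ← map_sub]
    congr 2
    abel
  have h := intervalIntegral.integral_eq_sub_of_hasDeriv_right_of_le ht hc hd
    ((T.continuous_flow_comp (continuous_sub_left t) hf).intervalIntegrable 0 t)
  simp only [sub_self, flow_zero, sub_zero] at h
  rw [h]; abel

theorem HasGen.integral_flow [CompleteSpace X] {T : C0Semigroup X} {x y : X} (h : T.HasGen x y)
    {t : ℝ} (ht : 0 ≤ t) : ∫ s in 0..t, T.flow s y = T.flow t x - x := by
  have := intervalIntegral.integral_eq_sub_of_hasDeriv_right_of_le ht
    (T.continuous_flow_apply x).continuousOn (fun s hs => h.hasDerivWithinAt hs.1.le)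
    ((T.continuous_flow_apply y).intervalIntegrable 0 t)
  simpa using this

theorem hasGen_integral [CompleteSpace X] (T : C0Semigroup X) {t : ℝ} (ht : 0 ≤ t) (x : X) :
    T.HasGen (∫ s in 0..t, T.flow s x) (T.flow t x - x) := by
  have hc := T.continuous_flow_apply x
  have hi := fun a b => hc.intervalIntegrable (μ := volume) a b
  -- `T(h) ∫₀ᵗ T(s) x ds = ∫₀^{t+h} T(s) x ds - ∫₀ʰ T(s) x ds` is differentiable in `h`
  have hd : HasDerivAt (fun h : ℝ => (∫ s in 0..(t + h), T.flow s x) - ∫ s in 0..h, T.flow s x)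
      (T.flow t x - x) 0 := by
    have h1 := intervalIntegral.integral_hasDerivAt_right (hi 0 (t + 0))
      (hc.stronglyMeasurableAtFilter _ _) hc.continuousAt
    have h1' := HasDerivAt.scomp (h := fun h : ℝ => t + h) 0 h1
      ((hasDerivAt_id (0 : ℝ)).const_add t)
    have h2 := intervalIntegral.integral_hasDerivAt_right (hi 0 0)
      (hc.stronglyMeasurableAtFilter _ _) hc.continuousAt
    simpa using h1'.fun_sub h2
  refine hd.hasDerivWithinAt.congr_of_eventuallyEq ?_ (by simp)
  filter_upwards [self_mem_nhdsWithin] with h hh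
  have hh : 0 < h := hh
  rw [← (T.flow h).intervalIntegral_comp_comm (hi 0 t), intervalIntegral.integral_congr
    (g := fun s => T.flow (s + h) x),
    intervalIntegral.integral_comp_add_right (fun s => T.flow s x), zero_add,
    eq_sub_iff_add_eq, add_comm, intervalIntegral.integral_add_adjacent_intervals (hi _ _) (hi _ _)]
  intro s hs
  rw [uIcc_of_le ht] at hs
  simp only
  rw [add_comm, T.flow_add hh.le hs.1]

/-- The means `t⁻¹ ∫₀ᵗ T(s) x ds` lie in the domain of the generator and tend to `x`. -/
theorem dense_hasGen [CompleteSpace X] (T : C0Semigroup X) : Dense {x | ∃ y, T.HasGen x y} := by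
  intro x
  have hc := T.continuous_flow_apply x
  have h1 := intervalIntegral.integral_hasDerivAt_right (hc.intervalIntegrable (μ := volume) 0 0)
      (hc.stronglyMeasurableAtFilter _ _) hc.continuousAt
  have h2 := (hasDerivWithinAt_iff_tendsto_slope' (s := Ioi (0 : ℝ)) (by simp)).1
    h1.hasDerivWithinAt
  rw [flow_zero] at h2
  refine mem_closure_of_tendsto h2 ?_
  filter_upwards [self_mem_nhdsWithin] with t ht
  refine ⟨(t⁻¹ : ℂ) • (T.flow t x - x), ?_⟩
  have := (T.hasGen_integral (le_of_lt ht) x).smul (t⁻¹ : ℂ)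
  simpa [slope, ← Complex.ofReal_inv, Complex.coe_smul] using this

end C0Semigroup

end Flow

/-! ### Rescaled semigroups and the resolvent -/

section Resolvent

variable {X Y : Type*} [NormedAddCommGroup X] [NormedSpace ℂ X]
  [NormedAddCommGroup Y] [NormedSpace ℂ Y]

namespace C0Semigroup

/-- The semigroup `exp (-lam t) T(t)`, whose generator is `A - lam` if `A` is that of `T`. -/
def rescale (T : C0Semigroup X) (lam : ℂ) : C0Semigroup X where
  op t := Complex.exp (-(lam * t)) • T.op t
  op_zero := by simp [T.op_zero]
  op_add s t hs ht := by
    ext x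
    simp only [T.op_add s t hs ht, Complex.ofReal_add, mul_add, neg_add, Complex.exp_add,
      FunLike.coe_smul, Pi.smul_apply, ContinuousLinearMap.comp_apply, map_smul, mul_smul]
    rw [smul_comm]
  continuousOn_orbit x :=
    ContinuousOn.smul (by fun_prop) (T.continuousOn_orbit x)

theorem rescale_flow (T : C0Semigroup X) (lam : ℂ) {t : ℝ} (ht : 0 ≤ t) :
    (T.rescale lam).flow t = Complex.exp (-(lam * t)) • T.flow t := by
  rw [flow_of_nonneg _ ht, flow_of_nonneg _ ht, rescale]

theorem HasGen.congr {T T' : C0Semigroup X} (h : ∀ t, 0 ≤ t → T.flow t = T'.flow t) {x y : X}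
    (hx : T.HasGen x y) : T'.HasGen x y := by
  refine HasDerivWithinAt.congr_of_eventuallyEq hx ?_ (by simp)
  filter_upwards [self_mem_nhdsWithin] with t ht
  rw [h t (le_of_lt ht)]

theorem HasGen.rescale {T : C0Semigroup X} {x y : X} (hx : T.HasGen x y) (lam : ℂ) :
    (T.rescale lam).HasGen x (y - lam • x) := by
  have h1 : HasDerivAt (fun t : ℝ => Complex.exp (-(lam * t))) (-lam) 0 := by
    have := ((Complex.ofRealCLM.hasDerivAt (x := (0 : ℝ))).const_mul lam).fun_neg.cexp
    simpa using this
  have h2 := h1.hasDerivWithinAt (s := Ioi 0) |>.fun_smul hx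
  refine HasDerivWithinAt.congr_of_eventuallyEq (f := fun t : ℝ =>
    Complex.exp (-(lam * t)) • T.flow t x) ?_ ?_ (by simp)
  · convert h2 using 1
    simp [sub_eq_add_neg]
  · filter_upwards [self_mem_nhdsWithin] with t ht
    rw [T.rescale_flow lam (le_of_lt ht)]; rfl

theorem rescale_neg_rescale_flow (T : C0Semigroup X) (lam : ℂ) {t : ℝ} (ht : 0 ≤ t) :
    ((T.rescale lam).rescale (-lam)).flow t = T.flow t := by
  rw [rescale_flow _ _ ht, rescale_flow _ _ ht, smul_smul, ← Complex.exp_add]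
  simp

theorem hasGen_rescale_iff (T : C0Semigroup X) (lam : ℂ) {x y : X} :
    (T.rescale lam).HasGen x (y - lam • x) ↔ T.HasGen x y := by
  refine ⟨fun h => ?_, fun h => h.rescale lam⟩
  have := (h.rescale (-lam)).congr fun t ht => T.rescale_neg_rescale_flow lam ht
  simpa using this

theorem norm_exp_neg_mul (lam : ℂ) (t : ℝ) :
    ‖Complex.exp (-(lam * t))‖ = Real.exp (-(lam.re * t)) := by
  simp [Complex.norm_exp]

theorem norm_rescale_flow (T : C0Semigroup X) (lam : ℂ) {t : ℝ} (ht : 0 ≤ t) :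
    ‖(T.rescale lam).flow t‖ = Real.exp (-(lam.re * t)) * ‖T.flow t‖ := by
  rw [rescale_flow _ _ ht, norm_smul, norm_exp_neg_mul]

/-- `R = (lam - A)⁻¹` for the generator `A` of `T`. -/
def IsResolvent (T : C0Semigroup X) (lam : ℂ) (R : X →L[ℂ] X) : Prop :=
  ∀ x y, T.HasGen x y ↔ x = R (lam • x - y)

theorem IsResolvent.hasGen {T : C0Semigroup X} {lam : ℂ} {R : X →L[ℂ] X}
    (hR : T.IsResolvent lam R) (z : X) : T.HasGen (R z) (lam • R z - z) :=
  (hR _ _).2 (by simp)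

theorem IsResolvent.flow_comm {T : C0Semigroup X} {lam : ℂ} {R : X →L[ℂ] X}
    (hR : T.IsResolvent lam R) (t : ℝ) (z : X) :
    T.flow t (R z) = R (T.flow t z) := by
  simpa using (hR _ _).1 ((hR.hasGen z).flow t)

/-- If `‖exp (-lam τ) T(τ)‖ ≤ 1/2`, then `lam` lies in the resolvent set, and with
`N = 1 - exp (-lam τ) T(τ)` one has `(lam - A)⁻¹ N = ∫₀^τ exp (-lam s) T(s) ds`. The operator `N` is
onto, and preimages can be chosen with norm at most twice as large. -/
theorem exists_isResolvent [CompleteSpace X] (T : C0Semigroup X) {τ : ℝ} (hτ : 0 < τ) {lam : ℂ}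
    (hlam : Real.exp (-(lam.re * τ)) * ‖T.flow τ‖ ≤ 1 / 2) :
    ∃ R N : X →L[ℂ] X, T.IsResolvent lam R ∧
      (∀ w, R (N w) = ∫ s in 0..τ, Complex.exp (-(lam * s)) • T.flow s w) ∧
      ∀ z, ∃ w, N w = z ∧ ‖w‖ ≤ 2 * ‖z‖ := by
  set T' := T.rescale lam with hT'
  have hn : ‖T'.flow τ‖ ≤ 1 / 2 := by rwa [hT', norm_rescale_flow _ _ hτ.le]
  let u : (X →L[ℂ] X)ˣ := Units.oneSub (T'.flow τ) (hn.trans_lt (by norm_num))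
  let N : X →L[ℂ] X := u
  let V : X →L[ℂ] X := (u⁻¹ : (X →L[ℂ] X)ˣ)
  obtain ⟨M, hM1, hM⟩ := T'.exists_norm_flow_le τ
  let J : X →L[ℂ] X := LinearMap.mkContinuous
    { toFun := fun x => ∫ s in 0..τ, T'.flow s x
      map_add' := fun x y => by
        simp only [map_add]
        exact intervalIntegral.integral_add
          ((T'.continuous_flow_apply x).intervalIntegrable _ _)
          ((T'.continuous_flow_apply y).intervalIntegrable _ _)
      map_smul' := fun c x => by
        simp only [map_smul, RingHom.id_apply]
        exact intervalIntegral.integral_smul c _ } (M * |τ - 0|) (fun x => by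
    have := intervalIntegral.norm_integral_le_of_norm_le_const (a := 0) (b := τ)
      (f := fun s => T'.flow s x) (C := M * ‖x‖) (fun s hs => by
        rw [uIoc_of_le hτ.le] at hs
        exact (T'.flow s).le_of_opNorm_le (hM s hs.2) x)
    calc _ ≤ _ := this
      _ = _ := by ring)
  have hu : ∀ w, N w = w - T'.flow τ w := fun w => by simp [N, u]
  have huinv : ∀ z, N (V z) = z := fun z => by
    simp only [N, V, ← mul_apply_eq_comp, ← Units.val_mul]; simp
  have hinvu : ∀ z, V (N z) = z := fun z => by
    simp only [N, V, ← mul_apply_eq_comp, ← Units.val_mul]; simp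
  -- `(A - lam) J w = -N w`, so `J N⁻¹` is a right inverse of `lam - A`
  have hJ : ∀ w, T'.HasGen (J w) (T'.flow τ w - w) := fun w => T'.hasGen_integral hτ.le w
  have hR : ∀ z, T.HasGen (J (V z))
      (lam • J (V z) - z) := fun z => by
    rw [← hasGen_rescale_iff T lam]
    have h1 := hJ (V z)
    have h2 := huinv z
    rw [hu] at h2
    convert h1 using 1
    rw [← neg_sub (V z), h2]
    abel
  -- an eigenvector `d` of `A` for `lam` is fixed by the contraction `exp (-lam τ) T(τ)`
  have hinj : ∀ d, T.HasGen d (lam • d) → d = 0 := fun d hd => by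
    have h1 := hd.rescale lam
    rw [sub_self, ← hT'] at h1
    have h2 := h1.integral_flow hτ.le
    simp only [map_zero, intervalIntegral.integral_zero] at h2
    have h3 : ‖d‖ ≤ 1 / 2 * ‖d‖ := by
      calc ‖d‖ = ‖T'.flow τ d‖ := by rw [sub_eq_zero.1 h2.symm]
        _ ≤ _ := (T'.flow τ).le_of_opNorm_le hn d
    exact norm_le_zero_iff.1 (by linarith [norm_nonneg d])
  refine ⟨J ∘L V, N, fun x y => ⟨fun h => ?_, fun h => ?_⟩, fun w => ?_,
    fun z => ⟨V z, huinv z, ?_⟩⟩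
  · have h1 := h.sub (hR (lam • x - y))
    refine sub_eq_zero.1 (hinj _ ?_)
    rw [ContinuousLinearMap.comp_apply]
    convert h1 using 1
    rw [smul_sub]
    abel
  · have h1 := hR (lam • x - y)
    have h2 : x = J (V (lam • x - y)) := h
    rw [← h2] at h1
    simpa using h1
  · rw [ContinuousLinearMap.comp_apply, hinvu]
    change ∫ s in 0..τ, T'.flow s w = _
    refine intervalIntegral.integral_congr fun s hs => ?_
    rw [uIcc_of_le hτ.le] at hs
    simp [hT', T.rescale_flow lam hs.1]
  · have h1 := huinv z
    rw [hu, sub_eq_iff_eq_add] at h1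
    set w := V z
    have h2 : ‖w‖ ≤ ‖z‖ + 1 / 2 * ‖w‖ := by
      calc ‖w‖ = ‖z + T'.flow τ w‖ := by rw [← h1]
        _ ≤ ‖z‖ + ‖T'.flow τ w‖ := norm_add_le _ _
        _ ≤ _ := by gcongr; exact (T'.flow τ).le_of_opNorm_le hn w
    linarith

theorem exists_exp_mul_norm_flow_le (T : C0Semigroup X) {τ : ℝ} (hτ : 0 < τ) :
    ∃ ω : ℝ, 1 ≤ ω ∧ ∀ a, ω ≤ a → Real.exp (-(a * τ)) * ‖T.flow τ‖ ≤ 1 / 2 := by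
  have h : Tendsto (fun a : ℝ => Real.exp (-(a * τ)) * ‖T.flow τ‖) atTop (𝓝 (0 * ‖T.flow τ‖)) :=
    (Real.tendsto_exp_neg_atTop_nhds_zero.comp (tendsto_id.atTop_mul_const hτ)).mul_const _
  rw [zero_mul] at h
  obtain ⟨ω, hω⟩ := eventually_atTop.1 (h.eventually_le_const (by norm_num : (0 : ℝ) < 1 / 2))
  exact ⟨max ω 1, le_max_right _ _, fun a ha => hω a ((le_max_left _ _).trans ha)⟩

end C0Semigroup

theorem integral_exp_neg_mul_le {a τ : ℝ} (ha : 0 < a) :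
    ∫ s in 0..τ, Real.exp (-(a * s)) ≤ 1 / a := by
  have h : ∫ s in 0..τ, Real.exp (-(a * s)) = (1 - Real.exp (-(a * τ))) / a := by
    have := intervalIntegral.integral_comp_mul_left (a := 0) (b := τ) Real.exp (c := -a)
      (by linarith)
    simp only [neg_mul] at this
    rw [this, integral_exp]
    simp
    field_simp
    ring
  rw [h]
  gcongr
  linarith [Real.exp_pos (-(a * τ))]

/-- The Cauchy–Schwarz inequality for continuous functions on an interval. -/
theorem sq_integral_mul_le {f g : ℝ → ℝ} {a b : ℝ} (hab : a ≤ b) (hf : ContinuousOn f (Icc a b))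
    (hg : ContinuousOn g (Icc a b)) :
    (∫ s in a..b, f s * g s) ^ 2 ≤ (∫ s in a..b, f s ^ 2) * ∫ s in a..b, g s ^ 2 := by
  rw [← uIcc_of_le hab] at hf hg
  have h : ∀ c : ℝ, 0 ≤ (∫ s in a..b, f s ^ 2) * (c * c) +
      (2 * ∫ s in a..b, f s * g s) * c + ∫ s in a..b, g s ^ 2 := fun c => by
    have h1 : 0 ≤ ∫ s in a..b, (c * f s + g s) ^ 2 :=
      intervalIntegral.integral_nonneg hab fun s _ => sq_nonneg _
    have h2 : ∫ s in a..b, (c * f s + g s) ^ 2 =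
        ∫ s in a..b, ((c * c) * f s ^ 2 + (2 * c) * (f s * g s) + g s ^ 2) :=
      intervalIntegral.integral_congr fun s _ => by ring
    rw [h2, intervalIntegral.integral_add (ContinuousOn.intervalIntegrable (by fun_prop))
      (ContinuousOn.intervalIntegrable (by fun_prop)), intervalIntegral.integral_add
      (ContinuousOn.intervalIntegrable (by fun_prop))
      (ContinuousOn.intervalIntegrable (by fun_prop)), intervalIntegral.integral_const_mul,
      intervalIntegral.integral_const_mul] at h1
    linarith
  -- the quadratic polynomial `c ↦ ∫ (c f + g)²` is nonnegative
  have := discrim_le_zero h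
  rw [discrim] at this
  linarith

end Resolvent

/-! ### Observation operators -/

section Observation

variable {X Y : Type*} [NormedAddCommGroup X] [NormedSpace ℂ X]
  [NormedAddCommGroup Y] [NormedSpace ℂ Y]

theorem evalOn_add (C : X →ₗ.[ℂ] Y) {x y : X} (hx : x ∈ C.domain) (hy : y ∈ C.domain) :
    evalOn C (x + y) = evalOn C x + evalOn C y := by
  rw [evalOn_of_mem C hx, evalOn_of_mem C hy, evalOn_of_mem C (add_mem hx hy), ← C.map_add]
  rfl

theorem evalOn_smul (C : X →ₗ.[ℂ] Y) (c : ℂ) {x : X} (hx : x ∈ C.domain) :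
    evalOn C (c • x) = c • evalOn C x := by
  rw [evalOn_of_mem C hx, evalOn_of_mem C (C.domain.smul_mem c hx), ← C.map_smul]
  rfl

theorem evalOn_sub (C : X →ₗ.[ℂ] Y) {x y : X} (hx : x ∈ C.domain) (hy : y ∈ C.domain) :
    evalOn C (x - y) = evalOn C x - evalOn C y := by
  rw [evalOn_of_mem C hx, evalOn_of_mem C hy, evalOn_of_mem C (sub_mem hx hy), ← C.map_sub]
  rfl

theorem C0Semigroup.exists_isResolvent_some [CompleteSpace X] (T : C0Semigroup X) :
    ∃ (lam : ℂ) (R : X →L[ℂ] X), T.IsResolvent lam R := by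
  obtain ⟨ω, -, hω⟩ := T.exists_exp_mul_norm_flow_le one_pos
  obtain ⟨R, -, hR, -⟩ := T.exists_isResolvent one_pos (lam := (ω : ℂ)) (by simpa using hω ω le_rfl)
  exact ⟨ω, R, hR⟩

/-- `C` is defined on the domain of the generator of `T` and bounded there for the graph norm. -/
structure IsRelBounded (T : C0Semigroup X) (C : X →ₗ.[ℂ] Y) : Prop where
  mem : ∀ {x y : X}, T.HasGen x y → x ∈ C.domain
  bounded : ∃ M : ℝ, ∀ x y : X, T.HasGen x y → ‖evalOn C x‖ ≤ M * (‖x‖ + ‖y‖)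

/-- The admissibility estimate on `[0, τ]` with constant `K`. -/
def AdmissibleOn (T : C0Semigroup X) (C : X →ₗ.[ℂ] Y) (τ K : ℝ) : Prop :=
  ∀ x y : X, T.HasGen x y → ∫ s in 0..τ, ‖evalOn C (T.flow s x)‖ ^ 2 ≤ K ^ 2 * ‖x‖ ^ 2

namespace IsRelBounded

variable {T : C0Semigroup X} {C : X →ₗ.[ℂ] Y}

theorem exists_evalOn_resolvent (hC : IsRelBounded T C) {lam : ℂ} {R : X →L[ℂ] X}
    (hR : T.IsResolvent lam R) : ∃ Γ : X →L[ℂ] Y, ∀ z, evalOn C (R z) = Γ z := by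
  obtain ⟨M, hM⟩ := hC.bounded
  refine ⟨LinearMap.mkContinuous
    { toFun := fun z => evalOn C (R z)
      map_add' := fun x y => by
        rw [map_add, evalOn_add C (hC.mem (hR.hasGen x)) (hC.mem (hR.hasGen y))]
      map_smul' := fun c x => by
        rw [map_smul, evalOn_smul C c (hC.mem (hR.hasGen x)), RingHom.id_apply] }
    (|M| * (‖R‖ + (‖lam‖ * ‖R‖ + 1))) (fun z => ?_), fun z => rfl⟩
  calc ‖evalOn C (R z)‖ ≤ M * (‖R z‖ + ‖lam • R z - z‖) := hM _ _ (hR.hasGen z)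
    _ ≤ |M| * (‖R z‖ + ‖lam • R z - z‖) := by gcongr; exact le_abs_self M
    _ ≤ |M| * (‖R‖ * ‖z‖ + (‖lam‖ * (‖R‖ * ‖z‖) + ‖z‖)) := by
        have h1 := R.le_opNorm z
        have h2 : ‖lam • R z - z‖ ≤ ‖lam‖ * ‖R z‖ + ‖z‖ :=
          (norm_sub_le _ _).trans (by rw [norm_smul])
        have h3 : ‖lam‖ * ‖R z‖ ≤ ‖lam‖ * (‖R‖ * ‖z‖) := by gcongr
        gcongr
        linarith
    _ = _ := by ring

/-- Observed orbits are continuous: `C T(t) x = C (lam - A)⁻¹ T(t) (lam - A) x`. -/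
theorem continuous_evalOn [CompleteSpace X] (hC : IsRelBounded T C) {x y : X}
    (h : T.HasGen x y) : Continuous fun t => evalOn C (T.flow t x) := by
  obtain ⟨lam, R, hR⟩ := T.exists_isResolvent_some
  obtain ⟨Γ, hΓ⟩ := hC.exists_evalOn_resolvent hR
  rw [(hR x y).1 h]
  simp only [hR.flow_comm, hΓ]
  exact Γ.continuous.comp (T.continuous_flow_apply _)

theorem evalOn_integral [CompleteSpace X] [CompleteSpace Y] (hC : IsRelBounded T C) {x y : X}
    (h : T.HasGen x y) {φ : ℝ → ℂ} (hφ : Continuous φ) (a b : ℝ) :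
    evalOn C (∫ s in a..b, φ s • T.flow s x) = ∫ s in a..b, φ s • evalOn C (T.flow s x) := by
  obtain ⟨lam, R, hR⟩ := T.exists_isResolvent_some
  obtain ⟨Γ, hΓ⟩ := hC.exists_evalOn_resolvent hR
  have hi : IntervalIntegrable (fun s => φ s • T.flow s (lam • x - y)) volume a b :=
    (hφ.smul (T.continuous_flow_apply _)).intervalIntegrable _ _
  have h1 := R.intervalIntegral_comp_comm hi
  have h2 := Γ.intervalIntegral_comp_comm hi
  rw [(hR x y).1 h]
  simp only [hR.flow_comm, hΓ, map_smul] at h1 h2 ⊢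
  rw [h1, hΓ, ← h2]

end IsRelBounded

namespace AdmissibleOn

variable {T : C0Semigroup X} {C : X →ₗ.[ℂ] Y} {τ K : ℝ}

/-- The Cauchy–Schwarz inequality turns the `L²` bound of admissibility into decay in `a`. -/
theorem integral_exp_mul_le [CompleteSpace X] (hC : IsRelBounded T C)
    (hK : AdmissibleOn T C τ K) (hτ : 0 ≤ τ) {a : ℝ} (ha : 0 < a) {x y : X} (h : T.HasGen x y) :
    ∫ s in 0..τ, Real.exp (-(a * s)) * ‖evalOn C (T.flow s x)‖ ≤ |K| / √a * ‖x‖ := by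
  have h1 := sq_integral_mul_le hτ (f := fun s => Real.exp (-(a * s)))
    (g := fun s => ‖evalOn C (T.flow s x)‖) (by fun_prop) (hC.continuous_evalOn h).norm.continuousOn
  have h2 : ∫ s in 0..τ, Real.exp (-(a * s)) ^ 2 ≤ 1 / a := by
    calc ∫ s in 0..τ, Real.exp (-(a * s)) ^ 2 = ∫ s in 0..τ, Real.exp (-(2 * a * s)) :=
          intervalIntegral.integral_congr fun s _ => by
            simp only [← Real.exp_nat_mul]; push_cast; ring_nf
      _ ≤ 1 / (2 * a) := integral_exp_neg_mul_le (by positivity)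
      _ ≤ 1 / a := by gcongr; linarith
  refine le_of_abs_le (abs_le_of_sq_le_sq ?_ (by positivity))
  calc _ ≤ _ := h1
    _ ≤ 1 / a * (K ^ 2 * ‖x‖ ^ 2) := by
        gcongr
        · exact intervalIntegral.integral_nonneg hτ fun s _ => by positivity
        · exact hK x y h
    _ = _ := by rw [mul_pow, div_pow, sq_abs, Real.sq_sqrt ha.le]; ring

/-- Admissibility does not depend on the length of the interval. -/
theorem exists_extend [CompleteSpace X] (hC : IsRelBounded T C) (hK : AdmissibleOn T C τ K)
    (hτ : 0 < τ) {τ' : ℝ} (hτ' : 0 ≤ τ') : ∃ K', AdmissibleOn T C τ' K' := by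
  have hind : ∀ n : ℕ, ∃ K', AdmissibleOn T C (n * τ) K' := fun n => by
    induction n with
    | zero => exact ⟨0, fun x y _ => by simp⟩
    | succ n ih =>
      obtain ⟨K', hK'⟩ := ih
      refine ⟨√(K ^ 2 + K' ^ 2 * ‖T.flow τ‖ ^ 2), fun x y h => ?_⟩
      have hc : Continuous fun s => ‖evalOn C (T.flow s x)‖ ^ 2 :=
        (hC.continuous_evalOn h).norm.pow 2
      rw [← intervalIntegral.integral_add_adjacent_intervals (hc.intervalIntegrable 0 τ)
        (hc.intervalIntegrable τ _)]
      have h1 : ∫ s in τ..((n + 1 : ℕ) * τ), ‖evalOn C (T.flow s x)‖ ^ 2 =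
          ∫ s in 0..(n * τ), ‖evalOn C (T.flow s (T.flow τ x))‖ ^ 2 := by
        have h2 := intervalIntegral.integral_comp_add_right (a := 0) (b := n * τ)
          (fun s => ‖evalOn C (T.flow s x)‖ ^ 2) τ
        rw [show (0 : ℝ) + τ = τ by ring, show n * τ + τ = ((n + 1 : ℕ) : ℝ) * τ by
          push_cast; ring] at h2
        rw [← h2]
        refine intervalIntegral.integral_congr fun s hs => ?_
        rw [uIcc_of_le (by positivity)] at hs
        simp only [T.flow_add hs.1 hτ.le]
      rw [h1, Real.sq_sqrt (by positivity)]
      have h3 := hK' _ _ (h.flow τ)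
      have h4 : ‖T.flow τ x‖ ^ 2 ≤ (‖T.flow τ‖ * ‖x‖) ^ 2 := by
        gcongr; exact (T.flow τ).le_opNorm x
      nlinarith [hK x y h, mul_le_mul_of_nonneg_left h4 (sq_nonneg K')]
  obtain ⟨n, hn⟩ := exists_nat_ge (τ' / τ)
  obtain ⟨K', hK'⟩ := hind n
  refine ⟨K', fun x y h => le_trans ?_ (hK' x y h)⟩
  have hc : Continuous fun s => ‖evalOn C (T.flow s x)‖ ^ 2 :=
        (hC.continuous_evalOn h).norm.pow 2
  refine intervalIntegral.integral_mono_interval le_rfl hτ' ((div_le_iff₀ hτ).1 hn)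
    (Eventually.of_forall fun s => by positivity) (hc.intervalIntegrable _ _)

/-- The resolvent and the observed resolvent `C (lam - A)⁻¹` exist on a right half-plane, with the
decay rates `1 / Re lam` and `1 / √(Re lam)`. -/
theorem exists_resolvent_bound [CompleteSpace X] [CompleteSpace Y] (hC : IsRelBounded T C)
    (hK : AdmissibleOn T C τ K) (hτ : 0 < τ) :
    ∃ ω M : ℝ, 1 ≤ ω ∧ 0 ≤ M ∧ ∀ lam : ℂ, ω ≤ lam.re →
      ∃ (R : X →L[ℂ] X) (Γ : X →L[ℂ] Y), T.IsResolvent lam R ∧ (∀ z, evalOn C (R z) = Γ z) ∧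
        ‖R‖ ≤ M / lam.re ∧ ‖Γ‖ ≤ M / √lam.re := by
  obtain ⟨ω, hω1, hω⟩ := T.exists_exp_mul_norm_flow_le hτ
  obtain ⟨M, hM1, hM⟩ := T.exists_norm_flow_le τ
  refine ⟨ω, 2 * (M + |K|), hω1, by positivity, fun lam hlam => ?_⟩
  have ha : 0 < lam.re := by linarith
  obtain ⟨R, N, hR, hRN, hN⟩ := T.exists_isResolvent hτ (hω _ hlam)
  obtain ⟨Γ, hΓ⟩ := hC.exists_evalOn_resolvent hR
  refine ⟨R, Γ, hR, hΓ, ?_, ?_⟩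
  · refine R.opNorm_le_bound (by positivity) fun z => ?_
    obtain ⟨w, rfl, hw⟩ := hN z
    rw [hRN]
    calc ‖∫ s in 0..τ, Complex.exp (-(lam * s)) • T.flow s w‖
        ≤ ∫ s in 0..τ, Real.exp (-(lam.re * s)) * (M * ‖w‖) := by
          refine intervalIntegral.norm_integral_le_of_norm_le hτ.le
            (Eventually.of_forall fun s hs => ?_)
            (Continuous.intervalIntegrable (by fun_prop) _ _)
          rw [norm_smul, C0Semigroup.norm_exp_neg_mul]
          gcongr
          exact (T.flow s).le_of_opNorm_le (hM s hs.2) w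
      _ ≤ 1 / lam.re * (M * ‖w‖) := by
          rw [intervalIntegral.integral_mul_const]
          gcongr
          exact integral_exp_neg_mul_le ha
      _ ≤ 1 / lam.re * ((M + |K|) * (2 * ‖N w‖)) := by
          gcongr
          linarith [abs_nonneg K]
      _ = _ := by ring
  -- `Γ N w = ∫₀^τ exp (-lam s) C T(s) w ds` makes sense for `w` in the domain, which is dense
  · have hD : ∀ w, ‖Γ (N w)‖ ≤ |K| / √lam.re * ‖w‖ := by
      have hcl : IsClosed {w | ‖Γ (N w)‖ ≤ |K| / √lam.re * ‖w‖} :=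
        isClosed_le (by fun_prop) (by fun_prop)
      refine fun w => hcl.closure_subset_iff.2 ?_ (T.dense_hasGen w)
      rintro w ⟨w', hw'⟩
      change ‖Γ (N w)‖ ≤ |K| / √lam.re * ‖w‖
      rw [← hΓ, hRN, hC.evalOn_integral hw' (by fun_prop)]
      refine le_trans (intervalIntegral.norm_integral_le_integral_norm hτ.le) ?_
      simp only [norm_smul, C0Semigroup.norm_exp_neg_mul]
      exact integral_exp_mul_le hC hK hτ.le ha hw'
    refine Γ.opNorm_le_bound (by positivity) fun z => ?_
    obtain ⟨w, rfl, hw⟩ := hN z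
    calc ‖Γ (N w)‖ ≤ |K| / √lam.re * ‖w‖ := hD w
      _ ≤ (M + |K|) / √lam.re * (2 * ‖N w‖) := by
          gcongr
          linarith
      _ = _ := by ring

end AdmissibleOn

theorem setLIntegral_enorm_sq_eq {E : Type*} [NormedAddCommGroup E] {g : ℝ → E}
    (hg : Continuous g) {τ : ℝ} (hτ : 0 ≤ τ) :
    ∫⁻ t in Icc 0 τ, ‖g t‖ₑ ^ 2 = ENNReal.ofReal (∫ t in 0..τ, ‖g t‖ ^ 2) := by
  rw [intervalIntegral.integral_of_le hτ, ← integral_Icc_eq_integral_Ioc,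
    ofReal_integral_eq_lintegral_ofReal]
  · refine lintegral_congr fun t => ?_
    rw [ENNReal.ofReal_pow (norm_nonneg _), ofReal_norm]
  · exact (hg.norm.pow 2).integrableOn_Icc
  · exact Eventually.of_forall fun t => by positivity

/-- Admissibility in terms of `HasGen` and integrals of continuous real functions. -/
theorem isAdmissibleObservation_iff [CompleteSpace X] {T : C0Semigroup X} {A : X →ₗ.[ℂ] X}
    (hA : T.IsGenerator A) {C : X →ₗ.[ℂ] Y} :
    IsAdmissibleObservation T A C ↔
      IsRelBounded T C ∧ ∃ τ K : ℝ, 0 < τ ∧ AdmissibleOn T C τ K := by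
  have hmem : ∀ {x y}, T.HasGen x y → ∃ h : x ∈ A.domain, A ⟨x, h⟩ = y := fun {x y} h => by
    obtain ⟨x', h1, h2⟩ := A.mem_graph_iff.1 (hA.mem_graph_iff.2 h)
    subst h1
    exact ⟨x'.2, h2⟩
  have heq : ∀ {τ : ℝ}, 0 ≤ τ → ∀ {x}, Continuous (fun t => evalOn C (T.flow t x)) →
      ∫⁻ t in Icc 0 τ, ‖evalOn C (T.op t x)‖ₑ ^ 2 =
        ENNReal.ofReal (∫ t in 0..τ, ‖evalOn C (T.flow t x)‖ ^ 2) := fun hτ x hx => by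
    rw [← setLIntegral_enorm_sq_eq hx hτ]
    refine setLIntegral_congr_fun measurableSet_Icc fun t ht => ?_
    simp only [T.flow_of_nonneg ht.1]
  constructor
  · intro hC
    have hC' : IsRelBounded T C := by
      refine ⟨fun h => hC.domain_le (hmem h).1, ?_⟩
      obtain ⟨M, hM⟩ := hC.bounded
      refine ⟨M, fun x y h => ?_⟩
      obtain ⟨hx, rfl⟩ := hmem h
      rw [evalOn_of_mem C (hC.domain_le hx)]
      exact hM x hx
    obtain ⟨τ, hτ, K, hK, h⟩ := hC.estimate
    refine ⟨hC', τ, K, hτ, fun x y hx => ?_⟩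
    have := h x (hmem hx).1
    rw [heq hτ.le (hC'.continuous_evalOn hx)] at this
    exact (ENNReal.ofReal_le_ofReal_iff (by positivity)).1 this
  · rintro ⟨hC, τ, K, hτ, hK⟩
    have hle : A.domain ≤ C.domain := fun x hx => hC.mem (hA.hasGen ⟨x, hx⟩)
    refine ⟨hle, ?_, τ, hτ, |K|, abs_nonneg K, fun x hx => ?_⟩
    · obtain ⟨M, hM⟩ := hC.bounded
      refine ⟨M, fun x hx => ?_⟩
      rw [← evalOn_of_mem C (hle hx)]
      exact hM x _ (hA.hasGen ⟨x, hx⟩)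
    · have hx' := hA.hasGen ⟨x, hx⟩
      rw [heq hτ.le (hC.continuous_evalOn hx'), sq_abs]
      exact ENNReal.ofReal_le_ofReal (hK x _ hx')

end Observation

/-! ### Integrals over a triangle and the convolution estimate -/

section Convolution

theorem enorm_sq_integral_le {E : Type*} [NormedAddCommGroup E] [NormedSpace ℝ E] {g : ℝ → E}
    (hg : Continuous g) {t : ℝ} (ht : 0 ≤ t) :
    ‖∫ r in 0..t, g r‖ₑ ^ 2 ≤ ENNReal.ofReal t * ∫⁻ r in Icc 0 t, ‖g r‖ₑ ^ 2 := by
  rw [setLIntegral_enorm_sq_eq hg ht, ← ENNReal.ofReal_mul ht, ← ofReal_norm,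
    ← ENNReal.ofReal_pow (norm_nonneg _)]
  refine ENNReal.ofReal_le_ofReal ?_
  have h1 := sq_integral_mul_le ht (f := fun _ => 1) (g := fun s => ‖g s‖) (by fun_prop)
    hg.norm.continuousOn
  simp only [one_mul, one_pow, intervalIntegral.integral_const, sub_zero, smul_eq_mul,
    mul_one] at h1
  refine le_trans ?_ h1
  gcongr
  exact intervalIntegral.norm_integral_le_integral_norm ht

theorem lintegral_triangle_swap {F : ℝ → ℝ → ENNReal} (hF : Measurable (Function.uncurry F))
    (σ : ℝ) : ∫⁻ t in Icc 0 σ, ∫⁻ r in Icc 0 t, F t r = ∫⁻ r in Icc 0 σ, ∫⁻ t in Icc r σ, F t r := by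
  have hm : MeasurableSet {p : ℝ × ℝ | 0 ≤ p.2 ∧ p.2 ≤ p.1 ∧ p.1 ≤ σ} := by measurability
  have h1 : ∀ t r : ℝ, (Icc 0 σ).indicator (fun t => (Icc 0 t).indicator (F t) r) t =
      {p : ℝ × ℝ | 0 ≤ p.2 ∧ p.2 ≤ p.1 ∧ p.1 ≤ σ}.indicator (Function.uncurry F) (t, r) := by
    intro t r
    simp only [indicator, mem_Icc, mem_ofPred_eq, Function.uncurry]
    split_ifs <;> first | rfl | (exfalso; grind)
  have h2 : ∀ t r : ℝ, (Icc 0 σ).indicator (fun r => (Icc r σ).indicator (fun t => F t r) t) r =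
      {p : ℝ × ℝ | 0 ≤ p.2 ∧ p.2 ≤ p.1 ∧ p.1 ≤ σ}.indicator (Function.uncurry F) (t, r) := by
    intro t r
    simp only [indicator, mem_Icc, mem_ofPred_eq, Function.uncurry]
    split_ifs <;> first | rfl | (exfalso; grind)
  have e1 : ∫⁻ t in Icc 0 σ, ∫⁻ r in Icc 0 t, F t r = ∫⁻ t, ∫⁻ r,
      {p : ℝ × ℝ | 0 ≤ p.2 ∧ p.2 ≤ p.1 ∧ p.1 ≤ σ}.indicator (Function.uncurry F) (t, r) := by
    rw [← lintegral_indicator measurableSet_Icc]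
    refine lintegral_congr fun t => ?_
    simp only [← h1]
    by_cases ht : t ∈ Icc 0 σ
    · simp only [indicator_of_mem ht, lintegral_indicator measurableSet_Icc]
    · simp [indicator_of_notMem ht]
  have e2 : ∫⁻ r in Icc 0 σ, ∫⁻ t in Icc r σ, F t r = ∫⁻ r, ∫⁻ t,
      {p : ℝ × ℝ | 0 ≤ p.2 ∧ p.2 ≤ p.1 ∧ p.1 ≤ σ}.indicator (Function.uncurry F) (t, r) := by
    rw [← lintegral_indicator measurableSet_Icc]
    refine lintegral_congr fun r => ?_
    simp only [← h2]
    by_cases hr : r ∈ Icc 0 σ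
    · simp only [indicator_of_mem hr, lintegral_indicator measurableSet_Icc]
    · simp [indicator_of_notMem hr]
  rw [e1, e2, lintegral_lintegral_swap]
  exact (hF.indicator hm).aemeasurable

theorem integral_triangle_swap {E : Type*} [NormedAddCommGroup E] [NormedSpace ℝ E]
    {F : ℝ → ℝ → E} (hF : Continuous (Function.uncurry F)) {σ : ℝ} (hσ : 0 ≤ σ) :
    ∫ t in 0..σ, ∫ r in 0..t, F t r = ∫ r in 0..σ, ∫ t in r..σ, F t r := by
  set D := {p : ℝ × ℝ | 0 < p.2 ∧ p.2 ≤ p.1 ∧ p.1 ≤ σ} with hD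
  have hm : MeasurableSet D := by measurability
  have h1 : ∀ t r : ℝ, (Ioc 0 σ).indicator (fun t => (Ioc 0 t).indicator (F t) r) t =
      D.indicator (Function.uncurry F) (t, r) := by
    intro t r
    simp only [indicator, mem_Ioc, hD, mem_ofPred_eq, Function.uncurry]
    split_ifs <;> first | rfl | (exfalso; grind)
  have h2 : ∀ r t : ℝ, (Ioc 0 σ).indicator (fun r => (Icc r σ).indicator (fun t => F t r) t) r =
      D.indicator (Function.uncurry F) (t, r) := by
    intro r t
    simp only [indicator, mem_Ioc, mem_Icc, hD, mem_ofPred_eq, Function.uncurry]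
    split_ifs <;> first | rfl | (exfalso; grind)
  have e1 : ∫ t in 0..σ, ∫ r in 0..t, F t r =
      ∫ t, ∫ r, D.indicator (Function.uncurry F) (t, r) := by
    rw [intervalIntegral.integral_of_le hσ, ← integral_indicator measurableSet_Ioc]
    refine integral_congr_ae (Eventually.of_forall fun t => ?_)
    simp only [← h1]
    by_cases ht : t ∈ Ioc 0 σ
    · simp only [indicator_of_mem ht, integral_indicator measurableSet_Ioc,
        intervalIntegral.integral_of_le ht.1.le]
    · simp [indicator_of_notMem ht]
  have e2 : ∫ r in 0..σ, ∫ t in r..σ, F t r =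
      ∫ r, ∫ t, D.indicator (Function.uncurry F) (t, r) := by
    rw [intervalIntegral.integral_of_le hσ, ← integral_indicator measurableSet_Ioc]
    refine integral_congr_ae (Eventually.of_forall fun r => ?_)
    simp only [← h2]
    by_cases hr : r ∈ Ioc 0 σ
    · simp only [indicator_of_mem hr, integral_indicator measurableSet_Icc,
        intervalIntegral.integral_of_le hr.2, integral_Icc_eq_integral_Ioc]
    · simp [indicator_of_notMem hr]
  rw [e1, e2]
  refine integral_integral_swap (f := fun t r => D.indicator (Function.uncurry F) (t, r)) ?_
  have h3 : IntegrableOn (Function.uncurry F) D (volume.prod volume) := by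
    refine (hF.continuousOn.integrableOn_compact
      (isCompact_Icc.prod isCompact_Icc : IsCompact (Icc (0 : ℝ) σ ×ˢ Icc (0 : ℝ) σ))).mono_set ?_
    rintro ⟨t, r⟩ ⟨h1, h2, h3⟩
    simp only [mem_prod, mem_Icc] at *
    exact ⟨⟨by linarith, h3⟩, by linarith, by linarith⟩
  exact h3.integrable_indicator hm

variable {X Y : Type*} [NormedAddCommGroup X] [NormedSpace ℂ X] [CompleteSpace X]
  [NormedAddCommGroup Y] [NormedSpace ℂ Y] [CompleteSpace Y]

theorem C0Semigroup.continuous_conv (T : C0Semigroup X) {f : ℝ → X} (hf : Continuous f) :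
    Continuous fun t => ∫ r in 0..t, T.flow (t - r) (f r) :=
  intervalIntegral.continuous_parametric_intervalIntegral_of_continuous
    (f := fun t r => T.flow (t - r) (f r))
    (T.continuous_flow_comp (continuous_fst.sub continuous_snd) (hf.comp continuous_snd))
    continuous_id

namespace AdmissibleOn

variable {T : C0Semigroup X} {C : X →ₗ.[ℂ] Y} {τ K : ℝ}

/-- The convolution estimate with the unbounded `C` replaced by `c C (lam - A)⁻¹`. -/
theorem lintegral_conv_resolvent_le (hC : IsRelBounded T C) (hK : AdmissibleOn T C τ K)
    {lam : ℂ} {R : X →L[ℂ] X} {Γ : X →L[ℂ] Y} (hR : T.IsResolvent lam R)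
    (hΓ : ∀ z, evalOn C (R z) = Γ z) (c : ℂ) {f : ℝ → X} (hf : Continuous f) {σ : ℝ}
    (hστ : σ ≤ τ) :
    ∫⁻ t in Icc 0 σ, ‖(c • Γ) (∫ r in 0..t, T.flow (t - r) (f r))‖ₑ ^ 2 ≤
      ENNReal.ofReal σ * (ENNReal.ofReal (K ^ 2 * ‖c • R‖ ^ 2) * ∫⁻ t in Icc 0 σ, ‖f t‖ₑ ^ 2) := by
  have hcF : Continuous (Function.uncurry fun t r => (c • Γ) (T.flow (t - r) (f r))) :=
    (c • Γ).continuous.comp (T.continuous_flow_comp (continuous_fst.sub continuous_snd)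
      (hf.comp continuous_snd))
  calc ∫⁻ t in Icc 0 σ, ‖(c • Γ) (∫ r in 0..t, T.flow (t - r) (f r))‖ₑ ^ 2
      ≤ ∫⁻ t in Icc 0 σ, ENNReal.ofReal σ *
          ∫⁻ r in Icc 0 t, ‖(c • Γ) (T.flow (t - r) (f r))‖ₑ ^ 2 := by
        refine setLIntegral_mono' measurableSet_Icc fun t ht => ?_
        have hc : Continuous fun r => T.flow (t - r) (f r) := by fun_prop
        rw [← (c • Γ).intervalIntegral_comp_comm (hc.intervalIntegrable _ _)]
        refine (enorm_sq_integral_le ((c • Γ).continuous.comp hc) ht.1).trans ?_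
        exact mul_le_mul' (ENNReal.ofReal_le_ofReal ht.2) le_rfl
    _ = ENNReal.ofReal σ * ∫⁻ t in Icc 0 σ,
          ∫⁻ r in Icc 0 t, ‖(c • Γ) (T.flow (t - r) (f r))‖ₑ ^ 2 :=
        lintegral_const_mul' _ _ ENNReal.ofReal_ne_top
    _ = ENNReal.ofReal σ * ∫⁻ r in Icc 0 σ,
          ∫⁻ t in Icc r σ, ‖(c • Γ) (T.flow (t - r) (f r))‖ₑ ^ 2 := by
        rw [lintegral_triangle_swap]
        exact hcF.enorm.measurable.pow_const 2
    _ ≤ ENNReal.ofReal σ * ∫⁻ r in Icc 0 σ, ENNReal.ofReal (K ^ 2 * ‖c • R‖ ^ 2) * ‖f r‖ₑ ^ 2 := by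
        refine mul_le_mul_right (setLIntegral_mono' measurableSet_Icc fun r hr => ?_) _
        have hz := hR.hasGen (c • f r)
        have hcz := hC.continuous_evalOn hz
        have e : ∀ t, (c • Γ) (T.flow (t - r) (f r)) =
            evalOn C (T.flow (t - r) (R (c • f r))) := fun t => by
          rw [hR.flow_comm, hΓ]; simp
        have hsub : Icc (0 : ℝ) (σ - r) ⊆ Icc 0 τ := Icc_subset_Icc_right (by linarith [hr.1])
        calc ∫⁻ t in Icc r σ, ‖(c • Γ) (T.flow (t - r) (f r))‖ₑ ^ 2
            = ∫⁻ s in Icc 0 (σ - r), ‖evalOn C (T.flow s (R (c • f r)))‖ₑ ^ 2 := by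
              simp only [e]
              rw [← lintegral_indicator measurableSet_Icc, ← lintegral_indicator measurableSet_Icc,
                ← lintegral_sub_right_eq_self ((Icc 0 (σ - r)).indicator _) r]
              refine lintegral_congr fun t => ?_
              simp only [indicator, mem_Icc, sub_nonneg, sub_le_sub_iff_right]
          _ ≤ ∫⁻ s in Icc 0 τ, ‖evalOn C (T.flow s (R (c • f r)))‖ₑ ^ 2 :=
              lintegral_mono_set hsub
          _ = ENNReal.ofReal (∫ s in 0..τ, ‖evalOn C (T.flow s (R (c • f r)))‖ ^ 2) :=
              setLIntegral_enorm_sq_eq hcz (by linarith [hr.1, hr.2])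
          _ ≤ ENNReal.ofReal (K ^ 2 * ‖c • R‖ ^ 2 * ‖f r‖ ^ 2) := by
              refine ENNReal.ofReal_le_ofReal ((hK _ _ hz).trans ?_)
              rw [mul_assoc, ← mul_pow ‖c • R‖]
              gcongr
              simpa using (c • R).le_opNorm (f r)
          _ = _ := by
              rw [ENNReal.ofReal_mul (by positivity), ENNReal.ofReal_pow (norm_nonneg (f r)),
                ofReal_norm]
    _ = _ := by rw [lintegral_const_mul' _ _ ENNReal.ofReal_ne_top]

/-- If the mild solution `u(t) = ∫₀ᵗ T(t-r) f(r) dr` stays in the domain of the generator, then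
`‖C u‖_{L²(0,σ)} ≤ const √σ ‖f‖_{L²(0,σ)}`. The approximations `lam C (lam - A)⁻¹` of `C` converge
pointwise on the domain because `C (lam - A)⁻¹ → 0`. -/
theorem exists_lintegral_conv_le (hC : IsRelBounded T C) (hK : AdmissibleOn T C τ K)
    (hτ : 0 < τ) :
    ∃ L : ℝ, 0 ≤ L ∧ ∀ σ ≤ τ, ∀ f : ℝ → X, Continuous f →
      (∀ t ∈ Icc 0 σ, ∃ y, T.HasGen (∫ r in 0..t, T.flow (t - r) (f r)) y) →
      ∫⁻ t in Icc 0 σ, ‖evalOn C (∫ r in 0..t, T.flow (t - r) (f r))‖ₑ ^ 2 ≤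
        ENNReal.ofReal σ * (ENNReal.ofReal L * ∫⁻ t in Icc 0 σ, ‖f t‖ₑ ^ 2) := by
  obtain ⟨ω, M, hω, hM, h⟩ := hK.exists_resolvent_bound hC hτ
  refine ⟨K ^ 2 * M ^ 2, by positivity, fun σ hστ f hf hu => ?_⟩
  set u := fun t => ∫ r in 0..t, T.flow (t - r) (f r) with hu_def
  have huc : Continuous u := T.continuous_conv hf
  have hl : ∀ n : ℕ, 0 < ω + n := fun n => by positivity
  choose R Γ hR hΓ hRM hΓM using fun n : ℕ => h ((ω + n : ℝ) : ℂ) (by simp)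
  have hlim : ∀ t ∈ Icc 0 σ, Tendsto (fun n : ℕ => ‖(((ω + n : ℝ) : ℂ) • Γ n) (u t)‖ₑ ^ 2) atTop
      (𝓝 (‖evalOn C (u t)‖ₑ ^ 2)) := fun t ht => by
    obtain ⟨y, hy⟩ := hu t ht
    -- `lam (lam - A)⁻¹ u = u + (lam - A)⁻¹ A u`
    have e : ∀ n : ℕ, (((ω + n : ℝ) : ℂ) • Γ n) (u t) = evalOn C (u t) + Γ n y := fun n => by
      have h1 := ((hR n) _ _).1 hy
      conv_rhs => rw [hu_def]
      simp only
      conv_rhs => enter [1]; rw [h1, hΓ]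
      simp [u]
    have h0 : Tendsto (fun n => Γ n y) atTop (𝓝 0) := by
      refine squeeze_zero_norm (a := fun n : ℕ => M / √(ω + n) * ‖y‖)
        (fun n => (Γ n).le_of_opNorm_le (by simpa using hΓM n) y) ?_
      have h2 : Tendsto (fun n : ℕ => √(ω + n)) atTop atTop :=
        Real.tendsto_sqrt_atTop.comp
          (tendsto_atTop_add_const_left _ _ tendsto_natCast_atTop_atTop)
      simpa using (h2.const_div_atTop M).mul_const ‖y‖
    simp only [e]
    have h3 := (tendsto_const_nhds (x := evalOn C (u t))).add h0
    rw [add_zero] at h3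
    exact ENNReal.Tendsto.pow h3.enorm
  calc ∫⁻ t in Icc 0 σ, ‖evalOn C (u t)‖ₑ ^ 2
      = ∫⁻ t in Icc 0 σ, liminf (fun n : ℕ => ‖(((ω + n : ℝ) : ℂ) • Γ n) (u t)‖ₑ ^ 2) atTop :=
        setLIntegral_congr_fun measurableSet_Icc fun t ht => (hlim t ht).liminf_eq.symm
    _ ≤ liminf (fun n : ℕ => ∫⁻ t in Icc 0 σ, ‖(((ω + n : ℝ) : ℂ) • Γ n) (u t)‖ₑ ^ 2) atTop :=
        lintegral_liminf_le fun n =>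
          (((((ω + n : ℝ) : ℂ) • Γ n).continuous.comp huc).enorm).measurable.pow_const 2
    _ ≤ _ := by
        refine liminf_le_of_frequently_le' (Frequently.of_forall fun n => ?_)
        refine (hK.lintegral_conv_resolvent_le hC (hR n) (hΓ n) _ hf hστ).trans ?_
        gcongr
        rw [norm_smul, Complex.norm_real, Real.norm_of_nonneg (hl n).le]
        have := hRM n
        rw [Complex.ofReal_re, le_div_iff₀ (hl n)] at this
        linarith

end AdmissibleOn

end Convolution

/-! ### Construction of the perturbed semigroup -/

section Volterra

open scoped NNReal BoundedContinuousFunction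

variable {X : Type*} [NormedAddCommGroup X] [NormedSpace ℂ X] [CompleteSpace X]

omit [CompleteSpace X] in
theorem norm_volterra_le {D : Submodule ℂ X} {γ : D →ₗ[ℂ] C(ℝ, X)} {c : ℝ}
    (hγ : ∀ (x : D) (t : ℝ), 0 ≤ t → ∫ r in 0..t, ‖γ x r‖ ≤ c * ‖x‖)
    (Φ : X →L[ℂ] (ℝ≥0 →ᵇ X)) (x : D) (t : ℝ≥0) :
    ‖∫ r in 0..(t : ℝ), Φ (γ x r) (t - r).toNNReal‖ ≤ c * ‖Φ‖ * ‖x‖ := by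
  calc ‖∫ r in 0..(t : ℝ), Φ (γ x r) (t - r).toNNReal‖
      ≤ ∫ r in 0..(t : ℝ), ‖Φ‖ * ‖γ x r‖ := by
        refine intervalIntegral.norm_integral_le_of_norm_le t.2 (Eventually.of_forall fun r _ => ?_)
          (Continuous.intervalIntegrable (by fun_prop) _ _)
        exact ((Φ (γ x r)).norm_coe_le_norm _).trans (Φ.le_opNorm _)
    _ ≤ ‖Φ‖ * (c * ‖x‖) := by
        rw [intervalIntegral.integral_const_mul]
        gcongr
        exact hγ x t t.2
    _ = _ := by ring

/-- An operator-valued Volterra equation, whose kernel `γ` is only defined on a dense subspace.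
It is solved by the contraction principle in `X →L (ℝ≥0 →ᵇ X)`: the integral operator extends from
the dense subspace and has norm at most `c < 1`. -/
theorem exists_volterra {D : Submodule ℂ X} (hD : Dense (D : Set X)) (Φ₀ : X →L[ℂ] (ℝ≥0 →ᵇ X))
    (γ : D →ₗ[ℂ] C(ℝ, X)) {c : ℝ} (hc0 : 0 ≤ c) (hc1 : c < 1)
    (hγ : ∀ (x : D) (t : ℝ), 0 ≤ t → ∫ r in 0..t, ‖γ x r‖ ≤ c * ‖x‖) :
    ∃ Φ : X →L[ℂ] (ℝ≥0 →ᵇ X), ∀ (x : D) (t : ℝ≥0),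
      Φ x t = Φ₀ x t + ∫ r in 0..(t : ℝ), Φ (γ x r) (t - r).toNNReal := by
  have hcont : ∀ (Φ : X →L[ℂ] (ℝ≥0 →ᵇ X)) (x : D),
      Continuous (Function.uncurry fun (t : ℝ≥0) (r : ℝ) => Φ (γ x r) (t - r).toNNReal) :=
    fun Φ x => by
      simp only [Function.uncurry_def]
      fun_prop
  have hcont' : ∀ (Φ : X →L[ℂ] (ℝ≥0 →ᵇ X)) (x : D) (t : ℝ≥0) (a b : ℝ),
      IntervalIntegrable (fun r => Φ (γ x r) (t - r).toNNReal) volume a b := fun Φ x t a b =>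
    Continuous.intervalIntegrable (by fun_prop) _ _
  let v : (X →L[ℂ] (ℝ≥0 →ᵇ X)) → D →ₗ[ℂ] (ℝ≥0 →ᵇ X) := fun Φ =>
    { toFun := fun x => BoundedContinuousFunction.ofNormedAddCommGroup
        (fun t : ℝ≥0 => ∫ r in 0..(t : ℝ), Φ (γ x r) (t - r).toNNReal)
        (intervalIntegral.continuous_parametric_intervalIntegral_of_continuous (hcont Φ x)
          NNReal.continuous_coe) _ (norm_volterra_le hγ Φ x)
      map_add' := fun x y => by
        ext t
        simp only [map_add, ContinuousMap.add_apply, BoundedContinuousFunction.coe_add,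
          Pi.add_apply, BoundedContinuousFunction.coe_ofNormedAddCommGroup]
        exact intervalIntegral.integral_add (hcont' Φ x t _ _) (hcont' Φ y t _ _)
      map_smul' := fun a x => by
        ext t
        simp only [map_smul, ContinuousMap.smul_apply, BoundedContinuousFunction.coe_smul,
          BoundedContinuousFunction.coe_ofNormedAddCommGroup, RingHom.id_apply]
        exact intervalIntegral.integral_smul _ _ }
  have hdr : DenseRange D.subtype := by simpa [DenseRange] using hD
  have hvn : ∀ Φ x, ‖v Φ x‖ ≤ c * ‖Φ‖ * ‖D.subtype x‖ := fun Φ x =>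
    (BoundedContinuousFunction.norm_le (by positivity)).2 (norm_volterra_le hγ Φ x)
  let V : (X →L[ℂ] (ℝ≥0 →ᵇ X)) → X →L[ℂ] (ℝ≥0 →ᵇ X) := fun Φ => (v Φ).extendOfNorm D.subtype
  have hV : ∀ Φ (x : D), V Φ x = v Φ x := fun Φ x =>
    LinearMap.extendOfNorm_eq hdr ⟨_, hvn Φ⟩ x
  have hlip : ∀ Φ Ψ, ‖V Φ - V Ψ‖ ≤ c * ‖Φ - Ψ‖ := fun Φ Ψ => by
    refine (V Φ - V Ψ).opNorm_le_bound (by positivity) fun x => ?_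
    have hcl : IsClosed {x | ‖(V Φ - V Ψ) x‖ ≤ c * ‖Φ - Ψ‖ * ‖x‖} :=
      isClosed_le (by fun_prop) (by fun_prop)
    refine hcl.closure_subset_iff.2 ?_ (hD x)
    intro x hx
    refine le_of_eq_of_le (congrArg norm ?_) (hvn (Φ - Ψ) ⟨x, hx⟩)
    rw [sub_apply, hV Φ ⟨x, hx⟩, hV Ψ ⟨x, hx⟩]
    ext t
    exact (intervalIntegral.integral_sub (hcont' Φ ⟨x, hx⟩ t _ _) (hcont' Ψ ⟨x, hx⟩ t _ _)).symm
  have hF : ContractingWith ⟨c, hc0⟩ fun Φ => Φ₀ + V Φ := by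
    refine ⟨hc1, LipschitzWith.of_dist_le_mul fun Φ Ψ => ?_⟩
    rw [dist_eq_norm, dist_eq_norm, add_sub_add_left_eq_sub]
    exact hlip Φ Ψ
  refine ⟨hF.fixedPoint, fun x t => ?_⟩
  have h1 : Φ₀ + V hF.fixedPoint = hF.fixedPoint := hF.fixedPoint_isFixedPt
  conv_lhs => rw [← h1]
  rw [add_apply, hV]
  rfl

omit [CompleteSpace X] in
/-- Uniqueness for the Volterra equation: a bounded solution of the homogeneous equation vanishes,
since each application of the equation gains a factor `c`. -/
theorem volterra_unique {D : Submodule ℂ X} (hD : Dense (D : Set X))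
    (γ : D →ₗ[ℂ] C(ℝ, X)) {c : ℝ} (hc0 : 0 ≤ c) (hc1 : c < 1)
    (hγ : ∀ (x : D) (t : ℝ), 0 ≤ t → ∫ r in 0..t, ‖γ x r‖ ≤ c * ‖x‖)
    {Δ : ℝ → X →L[ℂ] X} {B : ℝ} (hB : ∀ s, 0 ≤ s → ‖Δ s‖ ≤ B)
    (hΔ : ∀ (x : D) (s : ℝ), 0 ≤ s → Δ s x = ∫ r in 0..s, Δ (s - r) (γ x r)) {s : ℝ}
    (hs : 0 ≤ s) : Δ s = 0 := by
  have hB0 : 0 ≤ B := (norm_nonneg _).trans (hB 0 le_rfl)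
  have hn : ∀ (n : ℕ) (s : ℝ), 0 ≤ s → ‖Δ s‖ ≤ c ^ n * B := fun n => by
    induction n with
    | zero => simpa using hB
    | succ n ih =>
      intro s hs
      refine (Δ s).opNorm_le_bound (by positivity) fun x => ?_
      have hcl : IsClosed {x | ‖Δ s x‖ ≤ c ^ (n + 1) * B * ‖x‖} :=
        isClosed_le (by fun_prop) (by fun_prop)
      refine hcl.closure_subset_iff.2 ?_ (hD x)
      intro x hx
      rw [mem_ofPred_eq, hΔ ⟨x, hx⟩ s hs]
      calc ‖∫ r in 0..s, Δ (s - r) (γ ⟨x, hx⟩ r)‖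
          ≤ ∫ r in 0..s, c ^ n * B * ‖γ ⟨x, hx⟩ r‖ := by
            refine intervalIntegral.norm_integral_le_of_norm_le hs
              (Eventually.of_forall fun r hr => ?_)
              (Continuous.intervalIntegrable (by fun_prop) _ _)
            exact (Δ (s - r)).le_of_opNorm_le (ih _ (sub_nonneg.2 hr.2)) _
        _ ≤ c ^ n * B * (c * ‖x‖) := by
            rw [intervalIntegral.integral_const_mul]
            gcongr
            exact hγ ⟨x, hx⟩ s hs
        _ = _ := by ring
  have hlim : Tendsto (fun n : ℕ => c ^ n * B) atTop (𝓝 (0 * B)) :=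
    (tendsto_pow_atTop_nhds_zero_of_lt_one hc0 hc1).mul_const B
  rw [zero_mul] at hlim
  exact norm_le_zero_iff.1 (ge_of_tendsto' hlim fun n => hn n s hs)

end Volterra

section Perturbation

open scoped NNReal BoundedContinuousFunction

variable {X Y : Type*} [NormedAddCommGroup X] [NormedSpace ℂ X] [CompleteSpace X]
  [NormedAddCommGroup Y] [NormedSpace ℂ Y]

/-- The domain of the infinitesimal generator. -/
def C0Semigroup.genDomain {X : Type*} [NormedAddCommGroup X] [NormedSpace ℂ X]
    (T : C0Semigroup X) : Submodule ℂ X where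
  carrier := {x | ∃ y, T.HasGen x y}
  zero_mem' := ⟨0, C0Semigroup.HasGen.zero T⟩
  add_mem' := fun ⟨_, h⟩ ⟨_, h'⟩ => ⟨_, h.add h'⟩
  smul_mem' := fun c _ ⟨_, h⟩ => ⟨_, h.smul c⟩

/-- The semigroup `S` with `S(t) x = T(t) x + ∫₀ᵗ S(t-r) γ(x, r) dr`, for a covariant kernel `γ`.
The semigroup law holds because `s ↦ S(t+s) - S(t) S(s)` solves the homogeneous equation. -/
theorem exists_semigroup_of_volterra (T : C0Semigroup X) {M : ℝ} (hM : ∀ t, ‖T.flow t‖ ≤ M)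
    (γ : T.genDomain →ₗ[ℂ] C(ℝ, X)) {c : ℝ} (hc0 : 0 ≤ c) (hc1 : c < 1)
    (hγ : ∀ (x : T.genDomain) (t : ℝ), 0 ≤ t → ∫ r in 0..t, ‖γ x r‖ ≤ c * ‖x‖)
    (hshift : ∀ (x x' : T.genDomain) (s r : ℝ), 0 ≤ s → 0 ≤ r → (x' : X) = T.flow s x →
      γ x' r = γ x (r + s)) :
    ∃ S : C0Semigroup X, ∀ (x : T.genDomain) (t : ℝ), 0 ≤ t →
      S.flow t x = T.flow t x + ∫ r in 0..t, S.flow (t - r) (γ x r) := by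
  have hD : Dense (T.genDomain : Set X) := T.dense_hasGen
  let Φ₀ : X →L[ℂ] (ℝ≥0 →ᵇ X) := LinearMap.mkContinuous
    { toFun := fun x => BoundedContinuousFunction.ofNormedAddCommGroup
        (fun t : ℝ≥0 => T.flow t x) ((T.continuous_flow_apply x).comp NNReal.continuous_coe)
        (M * ‖x‖) (fun t => (T.flow t).le_of_opNorm_le (hM t) x)
      map_add' := fun x y => by ext t; simp
      map_smul' := fun c x => by ext t; simp } M
    (fun x => (BoundedContinuousFunction.norm_le
      (mul_nonneg ((norm_nonneg _).trans (hM 0)) (norm_nonneg x))).2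
      fun t => (T.flow t).le_of_opNorm_le (hM t) x)
  obtain ⟨Φ, hΦ⟩ := exists_volterra hD Φ₀ γ hc0 hc1 hγ
  let U : ℝ → X →L[ℂ] X := fun t => (BoundedContinuousFunction.evalCLM ℂ t.toNNReal).comp Φ
  have hUcont : Continuous fun p : ℝ × X => U p.1 p.2 := by
    change Continuous fun p : ℝ × X => Φ p.2 p.1.toNNReal
    fun_prop
  have hUc : ∀ {f : ℝ → ℝ} {g : ℝ → X}, Continuous f → Continuous g →
      Continuous fun r => U (f r) (g r) := fun hf hg => hUcont.comp (hf.prodMk hg)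
  have hU : ∀ (x : T.genDomain) (t : ℝ), 0 ≤ t →
      U t x = T.flow t x + ∫ r in 0..t, U (t - r) (γ x r) := fun x t ht => by
    have := hΦ x t.toNNReal
    rw [Real.coe_toNNReal t ht] at this
    refine this.trans ?_
    congr 1
    change T.flow (t.toNNReal : ℝ) x = T.flow t x
    rw [Real.coe_toNNReal t ht]
  have hUn : ∀ t, ‖U t‖ ≤ ‖Φ‖ := fun t => (U t).opNorm_le_bound (norm_nonneg _) fun x =>
    ((Φ x).norm_coe_le_norm _).trans (Φ.le_opNorm x)
  have hU0 : U 0 = ContinuousLinearMap.id ℂ X := by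
    refine ContinuousLinearMap.ext fun x => ?_
    have hcl : IsClosed {x | U 0 x = ContinuousLinearMap.id ℂ X x} :=
      isClosed_eq (by fun_prop) (by fun_prop)
    refine hcl.closure_subset_iff.2 (fun x hx => ?_) (hD x)
    simpa using hU ⟨x, hx⟩ 0 le_rfl
  have hmax : ∀ t, U (max t 0) = U t := fun t => by
    simp only [U, show (max t 0).toNNReal = t.toNNReal by ext; simp]
  clear_value U
  have hadd : ∀ s t, 0 ≤ s → 0 ≤ t → U (s + t) = (U s).comp (U t) := fun t s ht hs => by
    refine sub_eq_zero.1 (volterra_unique hD γ hc0 hc1 hγ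
      (Δ := fun s => U (t + s) - (U t).comp (U s)) (B := ‖Φ‖ + ‖Φ‖ * ‖Φ‖) (fun s _ => ?_)
      (fun x s hs => ?_) hs)
    · refine (norm_sub_le _ _).trans (add_le_add (hUn _) ?_)
      exact ((U t).opNorm_comp_le _).trans
        (mul_le_mul (hUn _) (hUn _) (norm_nonneg _) (norm_nonneg _))
    · have hxs : T.flow s x ∈ T.genDomain := by
        obtain ⟨y, hy⟩ := x.2
        exact ⟨_, hy.flow s⟩
      have hi : ∀ a b, IntervalIntegrable (fun r => U (t + s - r) (γ x r)) volume a b :=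
        fun a b => (hUc (by fun_prop) (by fun_prop)).intervalIntegrable _ _
      have hi' : IntervalIntegrable (fun r => U (s - r) (γ x r)) volume 0 s :=
        (hUc (by fun_prop) (by fun_prop)).intervalIntegrable _ _
      have h1 := hU x (t + s) (add_nonneg ht hs)
      rw [← intervalIntegral.integral_add_adjacent_intervals (hi 0 s) (hi s _),
        T.flow_add ht hs] at h1
      have h2 := hU ⟨_, hxs⟩ t ht
      have h3 : ∫ r in 0..t, U (t - r) (γ ⟨_, hxs⟩ r) = ∫ r in s..(t + s), U (t + s - r) (γ x r) := by
        have := intervalIntegral.integral_comp_add_right (a := 0) (b := t)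
          (fun r => U (t + s - r) (γ x r)) s
        rw [zero_add] at this
        rw [← this]
        refine intervalIntegral.integral_congr fun r hr => ?_
        rw [uIcc_of_le ht] at hr
        rw [hshift x ⟨_, hxs⟩ s r hs hr.1 rfl, add_sub_add_right_eq_sub]
      rw [h3] at h2
      have h4 := (U t).intervalIntegral_comp_comm hi'
      have h5 : ∫ r in 0..s, (U (t + (s - r)) - (U t).comp (U (s - r))) (γ x r) =
          (∫ r in 0..s, U (t + s - r) (γ x r)) - ∫ r in 0..s, U t (U (s - r) (γ x r)) := by
        have hi2 : IntervalIntegrable (fun r => U t (U (s - r) (γ x r))) volume 0 s :=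
          ((U t).continuous.comp (hUc (by fun_prop) (by fun_prop))).intervalIntegrable _ _
        rw [← intervalIntegral.integral_sub (hi 0 s) hi2]
        simp only [sub_apply, ContinuousLinearMap.comp_apply, add_sub_assoc]
      rw [h5, h4, sub_apply, ContinuousLinearMap.comp_apply, hU x s hs, map_add, h2, h1]
      abel
  let S : C0Semigroup X := ⟨U, hU0, hadd, fun x =>
    (hUcont.comp (continuous_id.prodMk continuous_const)).continuousOn⟩
  have hS : ∀ t, S.flow t = U t := hmax
  exact ⟨S, fun x t ht => by simpa only [hS] using hU x t ht⟩

/-- The generator of the perturbed semigroup extends the perturbed generator: substituting `r = t u`,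
the difference quotient of the integral is a mean of values near `g 0`. -/
theorem C0Semigroup.HasGen.of_volterra {T S : C0Semigroup X} {x y : X} {g : ℝ → X}
    (hg : Continuous g) (hx : T.HasGen x y)
    (h : ∀ t, 0 ≤ t → S.flow t x = T.flow t x + ∫ r in 0..t, S.flow (t - r) (g r)) :
    S.HasGen x (y + g 0) := by
  have h1 : HasDerivWithinAt (fun t => ∫ r in 0..t, S.flow (t - r) (g r)) (g 0) (Ioi 0) 0 := by
    rw [hasDerivWithinAt_iff_tendsto_slope' (by simp)]
    have hc : Continuous fun t : ℝ => ∫ u in (0 : ℝ)..1, S.flow (t - t * u) (g (t * u)) :=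
      intervalIntegral.continuous_parametric_intervalIntegral_of_continuous'
        (f := fun t u => S.flow (t - t * u) (g (t * u)))
        (S.continuous_flow_comp (by fun_prop) (by fun_prop)) 0 1
    have h2 : Tendsto (fun t : ℝ => ∫ u in (0 : ℝ)..1, S.flow (t - t * u) (g (t * u))) (𝓝[>] 0)
        (𝓝 (g 0)) := (hc.tendsto' 0 (g 0) (by simp)).mono_left nhdsWithin_le_nhds
    refine h2.congr' ?_
    filter_upwards [self_mem_nhdsWithin] with t ht
    have h3 := intervalIntegral.smul_integral_comp_mul_left (a := 0) (b := 1)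
      (fun r => S.flow (t - r) (g r)) t
    rw [mul_zero, mul_one] at h3
    simp only [slope, intervalIntegral.integral_same, vsub_eq_sub, sub_zero]
    rw [← h3, smul_smul, inv_mul_cancel₀ (ne_of_gt ht), one_smul]
  refine HasDerivWithinAt.congr_of_eventuallyEq (hx.fun_add h1) ?_ (by simp)
  filter_upwards [self_mem_nhdsWithin] with t ht
  exact h t (le_of_lt ht)

omit [CompleteSpace X] in
theorem C0Semigroup.norm_flow_le_of_half {T : C0Semigroup X} {τ M : ℝ} (hτ : 0 < τ)
    (hM : ∀ t ≤ τ, ‖T.flow t‖ ≤ M) (h : ‖T.flow τ‖ ≤ 1 / 2) (t : ℝ) : ‖T.flow t‖ ≤ M := by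
  have hM0 : 0 ≤ M := (norm_nonneg _).trans (hM τ le_rfl)
  have hn : ∀ n : ℕ, ∀ t ≤ (n + 1) * τ, ‖T.flow t‖ ≤ M := fun n => by
    induction n with
    | zero => simpa using hM
    | succ n ih =>
      intro t ht
      rcases le_total t τ with h1 | h1
      · exact hM t h1
      have e : T.flow t = (T.flow (t - τ)).comp (T.flow τ) := by
        ext x
        rw [ContinuousLinearMap.comp_apply, ← T.flow_add (sub_nonneg.2 h1) hτ.le]
        congr 2
        ring
      have h2 := ih (t - τ) (by push_cast at ht; linarith)
      rw [e]
      calc _ ≤ ‖T.flow (t - τ)‖ * ‖T.flow τ‖ := ContinuousLinearMap.opNorm_comp_le _ _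
        _ ≤ M * (1 / 2) := by gcongr
        _ ≤ M := by linarith
  obtain ⟨n, hn'⟩ := exists_nat_ge (t / τ)
  refine hn n t ?_
  rw [div_le_iff₀ hτ] at hn'
  linarith

omit [CompleteSpace X] in
/-- Rescaling preserves relative boundedness, the two generators having equivalent graph norms. -/
theorem IsRelBounded.rescale {T : C0Semigroup X} {C : X →ₗ.[ℂ] Y} (hC : IsRelBounded T C)
    (lam : ℂ) : IsRelBounded (T.rescale lam) C := by
  have h : ∀ {x y}, (T.rescale lam).HasGen x y → T.HasGen x (y + lam • x) := fun {x y} hx => by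
    rw [← C0Semigroup.hasGen_rescale_iff T lam]
    simpa using hx
  refine ⟨fun hx => hC.mem (h hx), ?_⟩
  obtain ⟨M, hM⟩ := hC.bounded
  refine ⟨|M| * (1 + ‖lam‖), fun x y hx => (hM x _ (h hx)).trans ?_⟩
  have h1 : ‖y + lam • x‖ ≤ ‖y‖ + ‖lam‖ * ‖x‖ := (norm_add_le _ _).trans (by rw [norm_smul])
  calc M * (‖x‖ + ‖y + lam • x‖) ≤ |M| * (‖x‖ + (‖y‖ + ‖lam‖ * ‖x‖)) := by
        gcongr
        exact le_abs_self M
    _ ≤ |M| * ((1 + ‖lam‖) * (‖x‖ + ‖y‖)) := by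
        gcongr
        nlinarith [norm_nonneg lam, norm_nonneg y, mul_nonneg (norm_nonneg lam) (norm_nonneg y)]
    _ = _ := by ring

/-- A bound for `∫₀^τ ‖C T(r) x‖ dr` on one interval `[0, τ]` with `‖T(τ)‖ ≤ 1/2` gives twice that
bound on all intervals. -/
theorem IsRelBounded.integral_norm_le_of_half {T : C0Semigroup X} {C : X →ₗ.[ℂ] Y}
    (hC : IsRelBounded T C) {τ δ : ℝ} (hτ : 0 < τ) (hδ : 0 ≤ δ) (h : ‖T.flow τ‖ ≤ 1 / 2)
    (hint : ∀ x y, T.HasGen x y → ∫ r in 0..τ, ‖evalOn C (T.flow r x)‖ ≤ δ * ‖x‖)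
    {x y : X} (hx : T.HasGen x y) {t : ℝ} (ht : 0 ≤ t) :
    ∫ r in 0..t, ‖evalOn C (T.flow r x)‖ ≤ 2 * δ * ‖x‖ := by
  have hn : ∀ (n : ℕ) (x y : X), T.HasGen x y →
      ∫ r in 0..(n * τ), ‖evalOn C (T.flow r x)‖ ≤ 2 * δ * ‖x‖ := fun n => by
    induction n with
    | zero => intro x y _; simp; positivity
    | succ n ih =>
      intro x y hx
      have hc := (hC.continuous_evalOn hx).norm
      rw [← intervalIntegral.integral_add_adjacent_intervals (hc.intervalIntegrable 0 τ)
        (hc.intervalIntegrable τ _)]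
      have h1 : ∫ s in τ..((n + 1 : ℕ) * τ), ‖evalOn C (T.flow s x)‖ =
          ∫ s in 0..(n * τ), ‖evalOn C (T.flow s (T.flow τ x))‖ := by
        have h2 := intervalIntegral.integral_comp_add_right (a := 0) (b := n * τ)
          (fun s => ‖evalOn C (T.flow s x)‖) τ
        rw [show (0 : ℝ) + τ = τ by ring, show n * τ + τ = ((n + 1 : ℕ) : ℝ) * τ by
          push_cast; ring] at h2
        rw [← h2]
        refine intervalIntegral.integral_congr fun s hs => ?_
        rw [uIcc_of_le (by positivity)] at hs
        simp only [T.flow_add hs.1 hτ.le]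
      rw [h1]
      have h3 := ih _ _ (hx.flow τ)
      have h4 : ‖T.flow τ x‖ ≤ 1 / 2 * ‖x‖ := (T.flow τ).le_of_opNorm_le h x
      nlinarith [hint x y hx, mul_le_mul_of_nonneg_left h4 hδ]
  obtain ⟨n, hn'⟩ := exists_nat_ge (t / τ)
  have hc := (hC.continuous_evalOn hx).norm
  refine le_trans ?_ (hn n x y hx)
  exact intervalIntegral.integral_mono_interval le_rfl ht ((div_le_iff₀ hτ).1 hn')
    (Eventually.of_forall fun s => norm_nonneg _) (hc.intervalIntegrable _ _)

/-- The perturbation `A + H C` of a generator `A` by a bounded `H` and an admissible `C` generates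
a semigroup. -/
theorem AdmissibleOn.exists_perturbation [CompleteSpace Y] {T : C0Semigroup X} {C : X →ₗ.[ℂ] Y}
    {τ K : ℝ} (hC : IsRelBounded T C) (hK : AdmissibleOn T C τ K) (hτ : 0 < τ) (H : Y →L[ℂ] X) :
    ∃ S : C0Semigroup X, ∀ x w, S.HasGen x w ↔ ∃ y, T.HasGen x y ∧ w = y + H (evalOn C x) := by
  obtain ⟨ω₁, hω₁1, hω₁⟩ := T.exists_exp_mul_norm_flow_le hτ
  -- `ω` is so large that the rescaled semigroup satisfies the smallness condition with `c = 1/2`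
  obtain ⟨ω, hω, hωH⟩ : ∃ ω : ℝ, ω₁ ≤ ω ∧ ‖H‖ * (2 * (|K| / √ω)) ≤ 1 / 2 := by
    have h1 : Tendsto (fun ω : ℝ => ‖H‖ * (2 * (|K| / √ω))) atTop (𝓝 (‖H‖ * (2 * 0))) :=
      ((Real.tendsto_sqrt_atTop.const_div_atTop _).const_mul _).const_mul _
    rw [mul_zero, mul_zero] at h1
    exact ((eventually_ge_atTop ω₁).and
      (h1.eventually_le_const (by norm_num : (0 : ℝ) < 1 / 2))).exists
  have hω0 : 0 < ω := by linarith
  set T' := T.rescale (ω : ℂ) with hT'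
  have hhalf : ‖T'.flow τ‖ ≤ 1 / 2 := by
    rw [hT', T.norm_rescale_flow _ hτ.le]
    exact hω₁ _ (by simpa using hω)
  obtain ⟨M, -, hM⟩ := T'.exists_norm_flow_le τ
  have hgen : ∀ {x y}, T'.HasGen x y → T.HasGen x (y + (ω : ℂ) • x) := fun {x y} hx => by
    rw [← C0Semigroup.hasGen_rescale_iff T (ω : ℂ)]
    simpa using hx
  have hC' : IsRelBounded T' C := hC.rescale _
  have hsmall : ∀ x y, T'.HasGen x y →
      ∫ r in 0..τ, ‖evalOn C (T'.flow r x)‖ ≤ |K| / √ω * ‖x‖ := fun x y hx => by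
    refine le_of_eq_of_le ?_ (hK.integral_exp_mul_le hC hτ.le hω0 (hgen hx))
    refine intervalIntegral.integral_congr fun r hr => ?_
    rw [uIcc_of_le hτ.le] at hr
    simp only [hT', T.rescale_flow _ hr.1, FunLike.coe_smul, Pi.smul_apply]
    rw [evalOn_smul C _ (hC.mem ((hgen hx).flow r)), norm_smul, C0Semigroup.norm_exp_neg_mul,
      Complex.ofReal_re]
  let γ : T'.genDomain →ₗ[ℂ] C(ℝ, X) :=
    { toFun := fun x => ⟨fun r => H (evalOn C (T'.flow r x)),
        H.continuous.comp (hC'.continuous_evalOn x.2.choose_spec)⟩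
      map_add' := fun x y => by
        ext r
        simp only [Submodule.coe_add, map_add, ContinuousMap.coe_mk, ContinuousMap.add_apply]
        rw [evalOn_add C (hC'.mem (x.2.choose_spec.flow r)) (hC'.mem (y.2.choose_spec.flow r)),
          map_add]
      map_smul' := fun c x => by
        ext r
        simp only [Submodule.coe_smul, map_smul, ContinuousMap.coe_mk, ContinuousMap.smul_apply,
          RingHom.id_apply]
        rw [evalOn_smul C _ (hC'.mem (x.2.choose_spec.flow r)), map_smul] }
  have hγ : ∀ (x : T'.genDomain) (t : ℝ), 0 ≤ t → ∫ r in 0..t, ‖γ x r‖ ≤ 1 / 2 * ‖x‖ :=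
    fun x t ht => by
      have hc := (hC'.continuous_evalOn x.2.choose_spec)
      calc ∫ r in 0..t, ‖γ x r‖ ≤ ∫ r in 0..t, ‖H‖ * ‖evalOn C (T'.flow r x)‖ :=
            intervalIntegral.integral_mono_on ht (Continuous.intervalIntegrable (by fun_prop) _ _)
              (Continuous.intervalIntegrable (by fun_prop) _ _) fun r _ => H.le_opNorm _
        _ ≤ ‖H‖ * (2 * (|K| / √ω) * ‖(x : X)‖) := by
            rw [intervalIntegral.integral_const_mul]
            gcongr
            exact hC'.integral_norm_le_of_half hτ (by positivity) hhalf hsmall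
              x.2.choose_spec ht
        _ = ‖H‖ * (2 * (|K| / √ω)) * ‖(x : X)‖ := by ring
        _ ≤ _ := by gcongr; rfl
  obtain ⟨S', hS'⟩ := exists_semigroup_of_volterra T'
    (C0Semigroup.norm_flow_le_of_half hτ hM hhalf) γ (by norm_num) (by norm_num) hγ
    (fun x x' s r hs hr hxx' => by
      change H (evalOn C (T'.flow r x')) = H (evalOn C (T'.flow (r + s) x))
      rw [hxx', T'.flow_add hr hs])
  set S := S'.rescale (-(ω : ℂ)) with hS
  have hfwd : ∀ x y, T.HasGen x y → S.HasGen x (y + H (evalOn C x)) := fun x y hx => by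
    have hx' := hx.rescale (ω : ℂ)
    have h1 := C0Semigroup.HasGen.of_volterra (γ ⟨x, _, hx'⟩).continuous hx'
      (hS' ⟨x, _, hx'⟩)
    have h2 := h1.rescale (-(ω : ℂ))
    convert h2 using 1
    change _ = y - (ω : ℂ) • x + H (evalOn C (T'.flow 0 x)) - -(ω : ℂ) • x
    rw [C0Semigroup.flow_zero, neg_smul]
    abel
  refine ⟨S, fun x w => ⟨fun hx => ?_, ?_⟩⟩
  · -- for large `lam` both `lam - A - H C` is onto and `lam` is in the resolvent set of `S`
    obtain ⟨ω₂, M₂, hω₂, hM₂, hres⟩ := hK.exists_resolvent_bound hC hτ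
    obtain ⟨ω₃, hω₃1, hω₃⟩ := S.exists_exp_mul_norm_flow_le one_pos
    have h1 : Tendsto (fun a : ℝ => ‖H‖ * (M₂ / √a)) atTop (𝓝 (‖H‖ * 0)) :=
      (Real.tendsto_sqrt_atTop.const_div_atTop _).const_mul _
    rw [mul_zero] at h1
    obtain ⟨a, ha2, ha3, haH⟩ := ((eventually_ge_atTop ω₂).and ((eventually_ge_atTop ω₃).and
      (h1.eventually_lt_const one_pos))).exists
    obtain ⟨R, Γ, hR, hΓ, -, hΓM⟩ := hres (a : ℂ) (by simpa using ha2)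
    obtain ⟨RS, -, hRS, -⟩ := S.exists_isResolvent one_pos (lam := (a : ℂ))
      (by simpa using hω₃ a ha3)
    have hHΓ : ‖H ∘L Γ‖ < 1 := by
      refine lt_of_le_of_lt ((H.opNorm_comp_le Γ).trans ?_) haH
      gcongr
      simpa using hΓM
    obtain ⟨ζ, hζ⟩ : ∃ ζ, ζ - H (Γ ζ) = (a : ℂ) • x - w := by
      refine ⟨((Units.oneSub (H ∘L Γ) hHΓ)⁻¹ : (X →L[ℂ] X)ˣ).1 ((a : ℂ) • x - w), ?_⟩
      have h3 : ∀ z, ((Units.oneSub (H ∘L Γ) hHΓ) : X →L[ℂ] X)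
          (((Units.oneSub (H ∘L Γ) hHΓ)⁻¹ : (X →L[ℂ] X)ˣ).1 z) = z := fun z => by
        rw [← mul_apply_eq_comp, ← Units.val_mul, mul_inv_cancel]
        simp
      exact h3 _
    have h4 := hfwd _ _ (hR.hasGen ζ)
    rw [hΓ] at h4
    have h5 : R ζ = x := by
      rw [(hRS _ _).1 h4, (hRS _ _).1 hx, ← hζ]
      congr 1
      abel
    rw [← h5, hΓ]
    refine ⟨_, hR.hasGen ζ, ?_⟩
    rw [h5]
    rw [sub_add, hζ]
    abel
  · rintro ⟨y, hy, rfl⟩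
    exact hfwd x y hy

end Perturbation

/-! ### Admissibility for the perturbed semigroup -/

section PerturbedObservation

variable {X Y : Type*} [NormedAddCommGroup X] [NormedSpace ℂ X] [CompleteSpace X]
  [NormedAddCommGroup Y] [NormedSpace ℂ Y] [CompleteSpace Y]

variable {T S : C0Semigroup X} {C : X →ₗ.[ℂ] Y} {τ K : ℝ}

/-- The graph norm of `A + H C` dominates that of `A`: with `ζ = (lam - A) x` one has
`ζ = (lam - A - H C) x + H C (lam - A)⁻¹ ζ`, and the last term is at most `‖ζ‖ / 2` for large
`lam`. -/
theorem IsRelBounded.of_perturbation (hC : IsRelBounded T C) (hK : AdmissibleOn T C τ K)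
    (hτ : 0 < τ) {H : Y →L[ℂ] X}
    (hS : ∀ x w, S.HasGen x w ↔ ∃ y, T.HasGen x y ∧ w = y + H (evalOn C x)) :
    IsRelBounded S C := by
  refine ⟨fun h => ?_, ?_⟩
  · obtain ⟨y, hy, -⟩ := (hS _ _).1 h
    exact hC.mem hy
  obtain ⟨ω, M, hω, hM, hres⟩ := hK.exists_resolvent_bound hC hτ
  have h1 : Tendsto (fun a : ℝ => ‖H‖ * (M / √a)) atTop (𝓝 (‖H‖ * 0)) :=
    (Real.tendsto_sqrt_atTop.const_div_atTop _).const_mul _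
  rw [mul_zero] at h1
  obtain ⟨a, ha, haH⟩ := ((eventually_ge_atTop ω).and
    (h1.eventually_le_const (by norm_num : (0 : ℝ) < 1 / 2))).exists
  obtain ⟨R, Γ, hR, hΓ, -, hΓM⟩ := hres (a : ℂ) (by simpa using ha)
  rw [Complex.ofReal_re] at hΓM
  refine ⟨‖Γ‖ * (2 * (a + 1)), fun x w hx => ?_⟩
  obtain ⟨y, hy, rfl⟩ := (hS _ _).1 hx
  set ζ := (a : ℂ) • x - y with hζ
  have hxζ : x = R ζ := (hR _ _).1 hy
  have hCx : evalOn C x = Γ ζ := by rw [← hΓ, ← hxζ]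
  rw [hCx]
  have h2 : ‖H (Γ ζ)‖ ≤ 1 / 2 * ‖ζ‖ := by
    calc ‖H (Γ ζ)‖ ≤ ‖H‖ * ((M / √a) * ‖ζ‖) :=
          H.le_opNorm_of_le (Γ.le_of_opNorm_le hΓM ζ)
      _ = ‖H‖ * (M / √a) * ‖ζ‖ := by ring
      _ ≤ _ := by gcongr
  have h3 : ‖ζ‖ ≤ a * ‖x‖ + ‖y + H (Γ ζ)‖ + 1 / 2 * ‖ζ‖ := by
    have e : ζ = (a : ℂ) • x - (y + H (Γ ζ)) + H (Γ ζ) := by rw [hζ]; abel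
    calc ‖ζ‖ = ‖(a : ℂ) • x - (y + H (Γ ζ)) + H (Γ ζ)‖ := by rw [← e]
      _ ≤ ‖(a : ℂ) • x‖ + ‖y + H (Γ ζ)‖ + ‖H (Γ ζ)‖ :=
          (norm_add_le _ _).trans (by gcongr; exact norm_sub_le _ _)
      _ ≤ _ := by
          rw [norm_smul, Complex.norm_real, Real.norm_of_nonneg (by linarith)]
          gcongr
  have h4 : ‖ζ‖ ≤ 2 * (a + 1) * (‖x‖ + ‖y + H (Γ ζ)‖) := by
    have := norm_nonneg x
    have := norm_nonneg (y + H (Γ ζ))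
    have h5 : 0 ≤ a * ‖y + H (Γ ζ)‖ := by
      have : 0 ≤ a := by linarith
      positivity
    nlinarith
  calc ‖Γ ζ‖ ≤ ‖Γ‖ * ‖ζ‖ := Γ.le_opNorm ζ
    _ ≤ ‖Γ‖ * (2 * (a + 1) * (‖x‖ + ‖y + H (Γ ζ)‖)) := by gcongr
    _ = _ := by ring

/-- Admissibility for the perturbed semigroup `S`. By variation of constants, `C S(t) x` is the sum
of `C T(t) x` and the observed convolution of `T` with `H C S(·) x`; on a short interval the
second term is absorbed into the left-hand side. -/
theorem AdmissibleOn.of_perturbation (hC : IsRelBounded T C) (hK : AdmissibleOn T C τ K)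
    (hτ : 0 < τ) {H : Y →L[ℂ] X}
    (hS : ∀ x w, S.HasGen x w ↔ ∃ y, T.HasGen x y ∧ w = y + H (evalOn C x)) :
    ∃ τ' K' : ℝ, 0 < τ' ∧ AdmissibleOn S C τ' K' := by
  have hCS := hC.of_perturbation hK hτ hS
  obtain ⟨L, hL, hconv⟩ := hK.exists_lintegral_conv_le hC hτ
  set q := 4 * (L * ‖H‖ ^ 2 + 1) with hq
  have hq0 : 0 < q := by positivity
  -- `σ` satisfies `2 σ L ‖H‖² ≤ 1/2`
  set σ := min τ (1 / q) with hσ_def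
  have hσ : 0 < σ := lt_min hτ (by positivity)
  have hσq : σ * (L * ‖H‖ ^ 2) ≤ 1 / 4 := by
    have h1 : σ * q ≤ 1 := by
      calc σ * q ≤ 1 / q * q := by gcongr; exact min_le_right _ _
        _ = 1 := by field_simp
    have : 0 ≤ σ := hσ.le
    linarith
  refine ⟨σ, 2 * K, hσ, fun x w hx => ?_⟩
  obtain ⟨y, hy, -⟩ := (hS _ _).1 hx
  have hcS := hCS.continuous_evalOn hx
  have hcT := hC.continuous_evalOn hy
  choose y' hy' hw' using fun t => (hS _ _).1 (hx.flow t)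
  set f : ℝ → X := fun t => H (evalOn C (S.flow t x)) with hf_def
  have hf : Continuous f := H.continuous.comp hcS
  have hduh : ∀ t, 0 ≤ t → S.flow t x = T.flow t x + ∫ r in 0..t, T.flow (t - r) (f r) :=
    fun t ht => by
      have := T.eq_flow_add_integral (x := fun t => S.flow t x) (x' := fun t => S.flow t w)
        (y := y') ht (S.continuous_flow_apply x).continuousOn
        (fun s hs => hx.hasDerivWithinAt hs.1) (fun s _ => hy' s) hf
        (fun s _ => by simp only [hf_def]; rw [hw' s]; abel)
      simpa using this
  have hu : ∀ t, 0 ≤ t → T.HasGen (∫ r in 0..t, T.flow (t - r) (f r)) (y' t - T.flow t y) :=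
    fun t ht => by
      have := (hy' t).sub (hy.flow t)
      rwa [hduh t ht, add_sub_cancel_left] at this
  have hCu : ∀ t, 0 ≤ t → evalOn C (∫ r in 0..t, T.flow (t - r) (f r)) =
      evalOn C (S.flow t x) - evalOn C (T.flow t x) := fun t ht => by
    rw [← evalOn_sub C (hC.mem (hy' t)) (hC.mem (hy.flow t)), hduh t ht, add_sub_cancel_left]
  have hcd : Continuous fun t => evalOn C (S.flow t x) - evalOn C (T.flow t x) := hcS.sub hcT
  have h1 := hconv σ (min_le_left _ _) f hf fun t ht => ⟨_, hu t ht.1⟩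
  rw [setLIntegral_congr_fun (g := fun t => ‖evalOn C (S.flow t x) - evalOn C (T.flow t x)‖ₑ ^ 2)
    measurableSet_Icc (fun t ht => by simp only [hCu t ht.1]),
    setLIntegral_enorm_sq_eq hcd hσ.le, setLIntegral_enorm_sq_eq hf hσ.le,
    ← ENNReal.ofReal_mul hL, ← ENNReal.ofReal_mul hσ.le, ENNReal.ofReal_le_ofReal_iff
      (mul_nonneg hσ.le (mul_nonneg hL (intervalIntegral.integral_nonneg hσ.le
        fun _ _ => by positivity)))] at h1
  have hint : ∀ {g : ℝ → ℝ}, Continuous g → IntervalIntegrable g volume 0 σ :=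
    fun hg => hg.intervalIntegrable _ _
  have h2 : ∫ t in 0..σ, ‖f t‖ ^ 2 ≤ ‖H‖ ^ 2 * ∫ t in 0..σ, ‖evalOn C (S.flow t x)‖ ^ 2 := by
    rw [← intervalIntegral.integral_const_mul]
    refine intervalIntegral.integral_mono_on hσ.le (hint (hf.norm.pow 2))
      (hint (continuous_const.mul (hcS.norm.pow 2))) fun t _ => ?_
    rw [← mul_pow]
    gcongr
    exact H.le_opNorm _
  have h3 : ∫ t in 0..σ, ‖evalOn C (S.flow t x)‖ ^ 2 ≤
      2 * (∫ t in 0..σ, ‖evalOn C (T.flow t x)‖ ^ 2) +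
      2 * ∫ t in 0..σ, ‖evalOn C (S.flow t x) - evalOn C (T.flow t x)‖ ^ 2 := by
    have hiT : IntervalIntegrable (fun t => 2 * ‖evalOn C (T.flow t x)‖ ^ 2) volume 0 σ :=
      hint (by fun_prop)
    have hid : IntervalIntegrable
        (fun t => 2 * ‖evalOn C (S.flow t x) - evalOn C (T.flow t x)‖ ^ 2) volume 0 σ :=
      hint (by fun_prop)
    rw [← intervalIntegral.integral_const_mul, ← intervalIntegral.integral_const_mul,
      ← intervalIntegral.integral_add hiT hid]
    refine intervalIntegral.integral_mono_on hσ.le (hint (hcS.norm.pow 2)) (hiT.add hid)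
      fun t _ => ?_
    have h4 : ‖evalOn C (S.flow t x)‖ ≤ ‖evalOn C (T.flow t x)‖ +
        ‖evalOn C (S.flow t x) - evalOn C (T.flow t x)‖ := by
      refine le_of_eq_of_le (congrArg norm ?_) (norm_add_le _ _)
      abel
    nlinarith [sq_nonneg (‖evalOn C (T.flow t x)‖ -
      ‖evalOn C (S.flow t x) - evalOn C (T.flow t x)‖), norm_nonneg (evalOn C (S.flow t x))]
  have h4 : ∫ t in 0..σ, ‖evalOn C (T.flow t x)‖ ^ 2 ≤ K ^ 2 * ‖x‖ ^ 2 := by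
    refine le_trans ?_ (hK x y hy)
    exact intervalIntegral.integral_mono_interval le_rfl hσ.le (min_le_left _ _)
      (Eventually.of_forall fun s => by positivity)
      ((hcT.norm.pow 2).intervalIntegrable _ _)
  have h5 : 0 ≤ ∫ t in 0..σ, ‖evalOn C (S.flow t x)‖ ^ 2 :=
    intervalIntegral.integral_nonneg hσ.le fun _ _ => by positivity
  have h6 : σ * (L * ∫ t in 0..σ, ‖f t‖ ^ 2) ≤
      1 / 4 * ∫ t in 0..σ, ‖evalOn C (S.flow t x)‖ ^ 2 := by
    calc σ * (L * ∫ t in 0..σ, ‖f t‖ ^ 2)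
        ≤ σ * (L * (‖H‖ ^ 2 * ∫ t in 0..σ, ‖evalOn C (S.flow t x)‖ ^ 2)) := by gcongr
      _ = σ * (L * ‖H‖ ^ 2) * ∫ t in 0..σ, ‖evalOn C (S.flow t x)‖ ^ 2 := by ring
      _ ≤ _ := by gcongr
  rw [mul_pow]
  linarith

end PerturbedObservation

/-! ### Mild and classical solutions -/

section Solutions

variable {X : Type*} [NormedAddCommGroup X] [NormedSpace ℂ X] [CompleteSpace X]

/-- The integral of the mild solution `m(t) = ∫₀ᵗ T(t-r) g(r) dr` lies in the domain of the
generator, which maps it to `m(t) - ∫₀ᵗ g`: by Fubini it is the convolution of `∫₀ᵗ T` with `g`. -/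
theorem C0Semigroup.hasGen_integral_conv (T : C0Semigroup X) {g : ℝ → X} (hg : Continuous g)
    {t : ℝ} (ht : 0 ≤ t) :
    T.HasGen (∫ s in 0..t, ∫ r in 0..s, T.flow (s - r) (g r))
      ((∫ r in 0..t, T.flow (t - r) (g r)) - ∫ r in 0..t, g r) := by
  obtain ⟨lam, R, hR⟩ := T.exists_isResolvent_some
  have hswap := integral_triangle_swap (F := fun s r => T.flow (s - r) (g r))
    (T.continuous_flow_comp (continuous_fst.sub continuous_snd) (hg.comp continuous_snd)) ht
  set J : ℝ → X := fun r => ∫ s in r..t, T.flow (s - r) (g r) with hJ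
  have hJc : Continuous J := by
    have h1 := intervalIntegral.continuous_parametric_intervalIntegral_of_continuous (a₀ := 0)
      (μ := volume) (f := fun (r : ℝ) (s : ℝ) => T.flow s (g r)) (s := fun r : ℝ => t - r)
      (T.continuous_flow_comp continuous_snd (hg.comp continuous_fst)) (by fun_prop)
    convert h1 using 2 with r
    have := intervalIntegral.integral_comp_sub_right (a := r) (b := t)
      (fun s => T.flow s (g r)) r
    rw [sub_self] at this
    exact this
  have hJR : ∀ r ∈ uIcc 0 t, J r = R (lam • J r - (T.flow (t - r) (g r) - g r)) := fun r hr => by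
    rw [uIcc_of_le ht] at hr
    refine (hR _ _).1 ?_
    have := T.hasGen_integral (sub_nonneg.2 hr.2) (g r)
    rwa [← sub_self r, ← intervalIntegral.integral_comp_sub_right] at this
  have hTc : Continuous fun r => T.flow (t - r) (g r) := by fun_prop
  have hi : ∀ {f : ℝ → X}, Continuous f → IntervalIntegrable f volume 0 t :=
    fun hf => hf.intervalIntegrable _ _
  rw [hswap, hR]
  change ∫ r in 0..t, J r = R (lam • (∫ r in 0..t, J r) - _)
  conv_lhs => rw [intervalIntegral.integral_congr hJR]
  rw [R.intervalIntegral_comp_comm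
      (hi (f := fun r => lam • J r - (T.flow (t - r) (g r) - g r)) (by fun_prop)),
    intervalIntegral.integral_sub (hi (f := fun r => lam • J r) (by fun_prop))
      (hi (f := fun r => T.flow (t - r) (g r) - g r) (by fun_prop)),
    intervalIntegral.integral_sub (hi hTc) (hi hg), intervalIntegral.integral_smul]

/-- The inhomogeneous equation `x' = A x + f` has a classical solution for `x₀` in the domain and a
continuously differentiable `f`. Its derivative is
`T(t) A x₀ + T(t) f(0) + ∫₀ᵗ T(t-r) f'(r) dr`. -/
theorem C0Semigroup.HasGen.exists_classical_solution {T : C0Semigroup X} {x₀ y₀ : X}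
    (hx : T.HasGen x₀ y₀) {f f' : ℝ → X} (hf' : Continuous f')
    (hf : ∀ t, 0 ≤ t → ∫ r in 0..t, f' r = f t - f 0) :
    ∃ x ρ : ℝ → X, x 0 = x₀ ∧ Continuous ρ ∧ (∀ t, HasDerivAt x (ρ t) t) ∧
      ∀ t, 0 ≤ t → T.HasGen (x t) (ρ t - f t) := by
  set m : ℝ → X := fun t => ∫ r in 0..t, T.flow (t - r) (f' r) with hm
  have hmc : Continuous m := T.continuous_conv hf'
  set ρ : ℝ → X := fun t => T.flow t y₀ + T.flow t (f 0) + m t with hρ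
  have hc1 := T.continuous_flow_apply y₀
  have hc2 := T.continuous_flow_apply (f 0)
  have hρc : Continuous ρ := (hc1.add hc2).add hmc
  refine ⟨fun t => x₀ + ∫ s in 0..t, ρ s, ρ, by simp, hρc, fun t => ?_, fun t ht => ?_⟩
  · exact (intervalIntegral.integral_hasDerivAt_right (hρc.intervalIntegrable _ _)
      (hρc.stronglyMeasurableAtFilter _ _) hρc.continuousAt).const_add x₀
  · have e : x₀ + ∫ s in 0..t, ρ s =
        T.flow t x₀ + (∫ s in 0..t, T.flow s (f 0)) + ∫ s in 0..t, m s := by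
      have h12 : IntervalIntegrable (fun s => T.flow s y₀ + T.flow s (f 0)) volume 0 t :=
        (hc1.add hc2).intervalIntegrable _ _
      have h1 := intervalIntegral.integral_add h12 (hmc.intervalIntegrable _ _)
      rw [intervalIntegral.integral_add (hc1.intervalIntegrable _ _)
        (hc2.intervalIntegrable _ _), hx.integral_flow ht] at h1
      rw [hρ, h1]
      abel
    change T.HasGen (x₀ + ∫ s in 0..t, ρ s) _
    rw [e]
    have h1 := ((hx.flow t).add (T.hasGen_integral ht (f 0))).add (T.hasGen_integral_conv hf' ht)
    rw [hf t ht] at h1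
    convert h1 using 1
    simp only [hρ, hm]
    abel

end Solutions

/-! ### Well-posedness and regularity with a bounded control operator -/

section Systems

variable {W X Y : Type*} [NormedAddCommGroup W] [NormedSpace ℂ W]
  [NormedAddCommGroup X] [NormedSpace ℂ X] [CompleteSpace X]
  [NormedAddCommGroup Y] [NormedSpace ℂ Y] [CompleteSpace Y]

theorem enorm_add_sq_le {E : Type*} [NormedAddCommGroup E] (x y : E) :
    ‖x + y‖ₑ ^ 2 ≤ 2 * ‖x‖ₑ ^ 2 + 2 * ‖y‖ₑ ^ 2 := by
  have h : ‖x + y‖ ^ 2 ≤ 2 * ‖x‖ ^ 2 + 2 * ‖y‖ ^ 2 := by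
    nlinarith [norm_add_le x y, norm_nonneg (x + y), sq_nonneg (‖x‖ - ‖y‖)]
  have h2 := ENNReal.ofReal_le_ofReal h
  rw [ENNReal.ofReal_add (by positivity) (by positivity), ENNReal.ofReal_mul (by norm_num),
    ENNReal.ofReal_mul (by norm_num), ENNReal.ofReal_pow (norm_nonneg _),
    ENNReal.ofReal_pow (norm_nonneg _), ENNReal.ofReal_pow (norm_nonneg _), ofReal_norm,
    ofReal_norm, ofReal_norm, ENNReal.ofReal_ofNat] at h2
  exact h2

theorem enorm_sq_le_of_norm_le {E F : Type*} [NormedAddCommGroup E] [NormedAddCommGroup F] {x : E}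
    {y : F} {c : ℝ} (h : ‖x‖ ≤ c * ‖y‖) : ‖x‖ₑ ^ 2 ≤ ENNReal.ofReal (c ^ 2) * ‖y‖ₑ ^ 2 := by
  rw [← ofReal_norm, ← ofReal_norm, ← ENNReal.ofReal_pow (norm_nonneg _),
    ← ENNReal.ofReal_pow (norm_nonneg _), ← ENNReal.ofReal_mul (sq_nonneg _), ← mul_pow]
  exact ENNReal.ofReal_le_ofReal (by gcongr)

namespace StateSystem

variable {S : StateSystem W X Y} {T : C0Semigroup X} {τ K : ℝ}

omit [CompleteSpace X] [CompleteSpace Y] in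
theorem IsClassicalTrajectory.hasGen {v : ℝ → W} {x : ℝ → X} {e : ℝ → Y}
    (h : S.IsClassicalTrajectory v x e) (hT : T.IsGenerator S.A) {t : ℝ} (ht : 0 ≤ t) :
    T.HasGen (x t) (derivWithin x (Ici 0) t - S.B (v t)) := by
  rw [h.state_eq t ht, add_sub_cancel_right]
  exact hT.hasGen ⟨x t, h.mem_domain t ht⟩

omit [CompleteSpace Y] in
/-- Variation of constants for classical trajectories. The input matters only at nonnegative times;
`max r 0` makes it continuous on `ℝ`. -/
theorem IsClassicalTrajectory.eq_flow_add {v : ℝ → W} {x : ℝ → X} {e : ℝ → Y}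
    (h : S.IsClassicalTrajectory v x e) (hT : T.IsGenerator S.A) {t : ℝ} (ht : 0 ≤ t) :
    x t = T.flow t (x 0) + ∫ r in 0..t, T.flow (t - r) (S.B (v (max r 0))) := by
  have hv : Continuous fun r => v (max r 0) :=
    h.continuousOn_input.comp_continuous (by fun_prop) fun t => le_max_right t 0
  refine T.eq_flow_add_integral (x' := derivWithin x (Ici 0)) ht
    (h.contDiffOn_state.continuousOn.mono Icc_subset_Ici_self) (fun s hs => ?_)
    (fun s hs => h.hasGen hT hs.1) (S.B.continuous.comp hv) (fun s hs => ?_)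
  · have h1 := (h.contDiffOn_state.differentiableOn one_ne_zero s hs.1).hasDerivWithinAt
    exact h1.mono (Ioi_subset_Ici hs.1)
  · simp [max_eq_left hs.1]

/-- The state and output estimates on an interval `[0, τ]` on which `C` is admissible. The output is
`C T(t) x(0) + C u(t) + D v(t)`, with `u` the convolution of `T` with `B v`. -/
theorem exists_trajectory_estimate (hT : T.IsGenerator S.A) (hC : IsRelBounded T S.C)
    (hK : AdmissibleOn T S.C τ K) (hτ : 0 < τ) :
    ∃ c : NNReal, ∀ (v : ℝ → W) (x : ℝ → X) (e : ℝ → Y), S.IsClassicalTrajectory v x e →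
      ‖x τ‖ₑ ^ 2 + ∫⁻ t in Icc 0 τ, ‖e t‖ₑ ^ 2 ≤
        (c : ENNReal) * (‖x 0‖ₑ ^ 2 + ∫⁻ t in Icc 0 τ, ‖v t‖ₑ ^ 2) := by
  obtain ⟨M, hM1, hM⟩ := T.exists_norm_flow_le τ
  obtain ⟨L, hL, hconv⟩ := hK.exists_lintegral_conv_le hC hτ
  set a := (M ^ 2).toNNReal
  set b := τ.toNNReal
  set k := (K ^ 2).toNNReal
  set l := L.toNNReal
  set β := (‖S.B‖ ^ 2).toNNReal
  set δ := (‖S.D‖ ^ 2).toNNReal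
  refine ⟨2 * a + 2 * (b * (a * β)) + 4 * k + 4 * (b * (l * β)) + 2 * δ, fun v x e h => ?_⟩
  have hvc : Continuous fun r => v (max r 0) :=
    h.continuousOn_input.comp_continuous (by fun_prop) fun t => le_max_right t 0
  set f : ℝ → X := fun r => S.B (v (max r 0)) with hf_def
  have hf : Continuous f := S.B.continuous.comp hvc
  set Iv := ∫⁻ t in Icc 0 τ, ‖v t‖ₑ ^ 2 with hIv
  have hIf : ∫⁻ t in Icc 0 τ, ‖f t‖ₑ ^ 2 ≤ β * Iv := by
    rw [hIv, ← lintegral_const_mul' _ _ ENNReal.coe_ne_top]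
    refine setLIntegral_mono' measurableSet_Icc fun t ht => ?_
    refine enorm_sq_le_of_norm_le ?_
    simp only [hf_def, max_eq_left ht.1]
    exact S.B.le_opNorm _
  set u : ℝ → X := fun t => ∫ r in 0..t, T.flow (t - r) (f r) with hu_def
  have hxu : ∀ t, 0 ≤ t → x t = T.flow t (x 0) + u t := fun t ht => h.eq_flow_add hT ht
  have hx0 := h.hasGen hT le_rfl
  have hu : ∀ t, 0 ≤ t → ∃ y, T.HasGen (u t) y := fun t ht => by
    have h1 := (h.hasGen hT ht).sub (hx0.flow t)
    rw [hxu t ht, add_sub_cancel_left] at h1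
    exact ⟨_, h1⟩
  have hX : ‖x τ‖ₑ ^ 2 ≤ 2 * (a * ‖x 0‖ₑ ^ 2) + 2 * (b * (a * (β * Iv))) := by
    rw [hxu τ hτ.le]
    refine (enorm_add_sq_le _ _).trans (add_le_add (mul_le_mul_right ?_ _)
      (mul_le_mul_right ?_ _))
    · exact enorm_sq_le_of_norm_le ((T.flow τ).le_of_opNorm_le (hM τ le_rfl) _)
    · refine (enorm_sq_integral_le (by fun_prop) hτ.le).trans (mul_le_mul_right ?_ _)
      calc ∫⁻ r in Icc 0 τ, ‖T.flow (τ - r) (f r)‖ₑ ^ 2 ≤ ∫⁻ r in Icc 0 τ, a * ‖f r‖ₑ ^ 2 :=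
            setLIntegral_mono' measurableSet_Icc fun r hr => enorm_sq_le_of_norm_le
              ((T.flow (τ - r)).le_of_opNorm_le (hM _ (by linarith [hr.1])) _)
        _ = a * ∫⁻ r in Icc 0 τ, ‖f r‖ₑ ^ 2 := lintegral_const_mul' _ _ ENNReal.coe_ne_top
        _ ≤ _ := by gcongr
  have hE : ∫⁻ t in Icc 0 τ, ‖e t‖ₑ ^ 2 ≤
      4 * (k * ‖x 0‖ₑ ^ 2) + 2 * (δ * Iv) + 4 * (b * (l * (β * Iv))) := by
    have hcT := hC.continuous_evalOn hx0
    have he : ∀ t ∈ Icc 0 τ, ‖e t‖ₑ ^ 2 ≤ 4 * ‖evalOn S.C (T.flow t (x 0))‖ₑ ^ 2 +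
        (2 * (δ * ‖v t‖ₑ ^ 2) + 4 * ‖evalOn S.C (u t)‖ₑ ^ 2) := fun t ht => by
      obtain ⟨y, hy⟩ := hu t ht.1
      have e1 : e t = (evalOn S.C (T.flow t (x 0)) + evalOn S.C (u t)) + S.D (v t) := by
        rw [h.output_eq t ht.1, ← evalOn_of_mem, ← evalOn_add _ (hC.mem (hx0.flow t)) (hC.mem hy),
          ← hxu t ht.1]
      rw [e1]
      calc _ ≤ 2 * ‖evalOn S.C (T.flow t (x 0)) + evalOn S.C (u t)‖ₑ ^ 2 +
            2 * ‖S.D (v t)‖ₑ ^ 2 := enorm_add_sq_le _ _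
        _ ≤ 2 * (2 * ‖evalOn S.C (T.flow t (x 0))‖ₑ ^ 2 + 2 * ‖evalOn S.C (u t)‖ₑ ^ 2) +
            2 * (δ * ‖v t‖ₑ ^ 2) := by
          gcongr
          · exact enorm_add_sq_le _ _
          · exact enorm_sq_le_of_norm_le (S.D.le_opNorm _)
        _ = _ := by ring
    have hvm : Measurable fun t => 2 * (δ * ‖v (max t 0)‖ₑ ^ 2) :=
      ((hvc.enorm.measurable.pow_const 2).const_mul _).const_mul _
    have hv : ∀ t ∈ Icc 0 τ, 2 * ((δ : ENNReal) * ‖v t‖ₑ ^ 2) = 2 * (δ * ‖v (max t 0)‖ₑ ^ 2) :=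
      fun t ht => by rw [max_eq_left ht.1]
    calc ∫⁻ t in Icc 0 τ, ‖e t‖ₑ ^ 2
        ≤ ∫⁻ t in Icc 0 τ, (4 * ‖evalOn S.C (T.flow t (x 0))‖ₑ ^ 2 +
          (2 * (δ * ‖v (max t 0)‖ₑ ^ 2) + 4 * ‖evalOn S.C (u t)‖ₑ ^ 2)) :=
          setLIntegral_mono' measurableSet_Icc fun t ht => by
            rw [← hv t ht]; exact he t ht
      _ = 4 * (∫⁻ t in Icc 0 τ, ‖evalOn S.C (T.flow t (x 0))‖ₑ ^ 2) +
          (2 * (δ * Iv) + 4 * ∫⁻ t in Icc 0 τ, ‖evalOn S.C (u t)‖ₑ ^ 2) := by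
          rw [lintegral_add_left ((hcT.enorm.measurable.pow_const 2).const_mul _),
            lintegral_add_left hvm, lintegral_const_mul' 4 _ (by norm_num),
            lintegral_const_mul' 4 _ (by norm_num), ← setLIntegral_congr_fun measurableSet_Icc hv,
            lintegral_const_mul' 2 _ (by norm_num), lintegral_const_mul' _ _ ENNReal.coe_ne_top]
      _ ≤ 4 * (k * ‖x 0‖ₑ ^ 2) + (2 * (δ * Iv) + 4 * (b * (l * (β * Iv)))) := by
          gcongr
          · rw [setLIntegral_enorm_sq_eq hcT hτ.le]
            refine (ENNReal.ofReal_le_ofReal (hK _ _ hx0)).trans ?_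
            rw [ENNReal.ofReal_mul (sq_nonneg K), ENNReal.ofReal_pow (norm_nonneg _), ofReal_norm]
            rfl
          · refine (hconv τ le_rfl f hf fun t ht => hu t ht.1).trans ?_
            exact mul_le_mul_right (mul_le_mul_right hIf _) _
      _ = _ := by ring
  refine (add_le_add hX hE).trans ?_
  push_cast
  set X₀ := ‖x 0‖ₑ ^ 2
  calc _ = (2 * a + 4 * k) * X₀ + (2 * (b * (a * β)) + 4 * (b * (l * β)) + 2 * δ) * Iv := by ring
    _ ≤ (2 * a + 4 * k) * (X₀ + Iv) +
        (2 * (b * (a * β)) + 4 * (b * (l * β)) + 2 * δ) * (X₀ + Iv) := by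
        gcongr
        · exact le_self_add
        · exact le_add_self
    _ = _ := by ring

/-- A system with bounded control operator and admissible observation operator is well-posed. -/
theorem isWellPosed_of_admissible (hT : T.IsGenerator S.A) (hC : IsRelBounded T S.C)
    (hK : AdmissibleOn T S.C τ K) (hτ : 0 < τ) : S.IsWellPosed where
  generates := ⟨T, hT⟩
  bounded_observation := by
    obtain ⟨M, hM⟩ := hC.bounded
    refine ⟨M, fun x => ?_⟩
    rw [← evalOn_of_mem]
    exact hM _ _ (hT.hasGen x)
  exists_trajectory := by
    intro x₀ hx₀ v hv
    have hd : Continuous fun r => S.B (derivWithin v (Ici 0) (max r 0)) :=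
      S.B.continuous.comp ((hv.continuousOn_derivWithin (uniqueDiffOn_Ici 0)
        le_rfl).comp_continuous (by fun_prop) fun t => le_max_right t 0)
    have hint : ∀ t, 0 ≤ t → ∫ r in 0..t, S.B (derivWithin v (Ici 0) (max r 0)) =
        S.B (v t) - S.B (v 0) := fun t ht => by
      refine intervalIntegral.integral_eq_sub_of_hasDeriv_right_of_le (f := fun r => S.B (v r)) ht
        ((S.B.continuous.comp_continuousOn hv.continuousOn).mono Icc_subset_Ici_self)
        (fun s hs => ?_) (hd.intervalIntegrable _ _)
      have h1 := (hv.differentiableOn one_ne_zero s hs.1.le).hasDerivWithinAt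
      have h2 := (S.B.restrictScalars ℝ).hasFDerivAt.comp_hasDerivWithinAt s
        (h1.mono (Ioi_subset_Ici hs.1.le))
      rw [max_eq_left hs.1.le]
      exact h2
    obtain ⟨x, ρ, hx0, hρ, hxρ, hgen⟩ :=
      (hT.hasGen ⟨x₀, hx₀⟩).exists_classical_solution (f := fun t => S.B (v t)) hd hint
    have hg : ∀ t, 0 ≤ t → (x t, ρ t - S.B (v t)) ∈ S.A.graph := fun t ht =>
      hT.mem_graph_iff.2 (hgen t ht)
    have hmem : ∀ t, 0 ≤ t → x t ∈ S.A.domain := fun t ht =>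
      LinearPMap.mem_domain_of_mem_graph (hg t ht)
    refine ⟨x, fun t => evalOn S.C (x t) + S.D (v t), ⟨hv.continuousOn, ?_, hmem, ?_, ?_⟩, hx0⟩
    · refine ContDiff.contDiffOn (contDiff_one_iff_deriv.2 ⟨fun t => (hxρ t).differentiableAt, ?_⟩)
      rwa [show deriv x = ρ from funext fun t => (hxρ t).deriv]
    · intro t ht
      rw [(hxρ t).hasDerivWithinAt.derivWithin (uniqueDiffOn_Ici 0 t ht)]
      obtain ⟨z, hz1, hz2⟩ := S.A.mem_graph_iff.1 (hg t ht)
      simp only at hz1 hz2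
      rw [← sub_eq_iff_eq_add, ← hz2]
      congr 1
      exact Subtype.ext hz1
    · intro t ht
      rw [evalOn_of_mem]
  estimate := fun τ' hτ' => by
    obtain ⟨K', hK'⟩ := hK.exists_extend hC hτ hτ'.le
    exact exists_trajectory_estimate hT hC hK' hτ'

end StateSystem

omit [CompleteSpace X] in
theorem C0Semigroup.IsResolvent.shifted_apply {T : C0Semigroup X} {A : X →ₗ.[ℂ] X}
    (hT : T.IsGenerator A) {lam : ℂ} {R : X →L[ℂ] X} (hR : T.IsResolvent lam R) (z : X) :
    ∃ h : R z ∈ A.domain, shifted A lam ⟨R z, h⟩ = z := by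
  obtain ⟨x, hx1, hx2⟩ := A.mem_graph_iff.1 (hT.mem_graph_iff.2 (hR.hasGen z))
  simp only at hx1 hx2
  refine ⟨hx1 ▸ x.2, ?_⟩
  have e : (⟨R z, hx1 ▸ x.2⟩ : A.domain) = x := Subtype.ext hx1.symm
  have h1 : shifted A lam x = lam • (x : X) - A x := rfl
  rw [e, h1, hx2, hx1]
  abel

omit [CompleteSpace X] in
theorem C0Semigroup.IsResolvent.inResolventSet {T : C0Semigroup X} {A : X →ₗ.[ℂ] X}
    (hT : T.IsGenerator A) {lam : ℂ} {R : X →L[ℂ] X} (hR : T.IsResolvent lam R) :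
    InResolventSet A lam := by
  have hinv : ∀ x : A.domain, (x : X) = R (shifted A lam x) := fun x => (hR _ _).1 (hT.hasGen x)
  refine ⟨⟨fun x y hxy => Subtype.ext ?_, fun z => ?_⟩, ‖R‖, fun x => ?_⟩
  · rw [hinv x, hinv y, hxy]
  · obtain ⟨h, h'⟩ := hR.shifted_apply hT z
    exact ⟨_, h'⟩
  · conv_lhs => rw [hinv x]
    exact R.le_opNorm _

omit [CompleteSpace X] in
theorem C0Semigroup.IsResolvent.resolventMap_apply {T : C0Semigroup X} {A : X →ₗ.[ℂ] X}
    (hT : T.IsGenerator A) {lam : ℂ} {R : X →L[ℂ] X} (hR : T.IsResolvent lam R) (z : X) :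
    (resolventMap A lam z : X) = R z := by
  have hb := (hR.inResolventSet hT).1
  obtain ⟨h, h'⟩ := hR.shifted_apply hT z
  rw [resolventMap, dif_pos hb]
  have : (LinearEquiv.ofBijective (shifted A lam) hb).symm z = ⟨R z, h⟩ := by
    rw [LinearEquiv.symm_apply_eq, LinearEquiv.ofBijective_apply, h']
  exact congrArg Subtype.val this

namespace StateSystem

variable {S : StateSystem W X Y} {T : C0Semigroup X} {τ K : ℝ}

omit [CompleteSpace X] [CompleteSpace Y] in
theorem transferFunction_apply (hT : T.IsGenerator S.A) {lam : ℂ} {R : X →L[ℂ] X}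
    (hR : T.IsResolvent lam R) {Γ : X →L[ℂ] Y} (hΓ : ∀ z, evalOn S.C (R z) = Γ z) (w : W) :
    S.transferFunction lam w = Γ (S.B w) + S.D w := by
  rw [← hΓ, ← hR.resolventMap_apply hT]
  rw [evalOn_of_mem S.C (S.domain_le (resolventMap S.A lam (S.B w)).2)]
  rfl

theorem eventually_inResolventSet (hT : T.IsGenerator S.A) (hC : IsRelBounded T S.C)
    (hK : AdmissibleOn T S.C τ K) (hτ : 0 < τ) :
    ∀ᶠ lam in comap Complex.re atTop, InResolventSet S.A lam := by
  obtain ⟨ω, M, -, -, hres⟩ := hK.exists_resolvent_bound hC hτ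
  filter_upwards [tendsto_comap.eventually (eventually_ge_atTop ω)] with lam hlam
  obtain ⟨R, Γ, hR, -⟩ := hres lam hlam
  exact hR.inResolventSet hT

theorem tendsto_transferFunction [FiniteDimensional ℂ W] (hT : T.IsGenerator S.A)
    (hC : IsRelBounded T S.C) (hK : AdmissibleOn T S.C τ K) (hτ : 0 < τ) :
    Tendsto (fun lam : ℂ => LinearMap.toContinuousLinearMap (S.transferFunction lam))
      (comap Complex.re atTop) (𝓝 S.D) := by
  obtain ⟨ω, M, hω, hM, hres⟩ := hK.exists_resolvent_bound hC hτ
  have h1 : Tendsto (fun lam : ℂ => M / √lam.re * ‖S.B‖) (comap Complex.re atTop) (𝓝 0) := by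
    have := ((Real.tendsto_sqrt_atTop.const_div_atTop M).mul_const ‖S.B‖).comp
      (tendsto_comap (f := Complex.re) (x := atTop))
    rwa [zero_mul] at this
  rw [tendsto_iff_norm_sub_tendsto_zero]
  refine squeeze_zero' (Eventually.of_forall fun _ => norm_nonneg _) ?_ h1
  filter_upwards [tendsto_comap.eventually (eventually_ge_atTop ω)] with lam hlam
  obtain ⟨R, Γ, hR, hΓ, -, hΓM⟩ := hres lam hlam
  refine ContinuousLinearMap.opNorm_le_bound _ (by positivity) fun w => ?_
  rw [sub_apply, LinearMap.coe_toContinuousLinearMap', transferFunction_apply hT hR hΓ,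
    add_sub_cancel_right, mul_assoc]
  exact Γ.le_of_opNorm_le_of_le hΓM (S.B.le_opNorm w)

theorem isRegularWith_of_admissible [FiniteDimensional ℂ W] (hT : T.IsGenerator S.A)
    (hC : IsRelBounded T S.C) (hK : AdmissibleOn T S.C τ K) (hτ : 0 < τ) :
    S.IsRegularWith S.D := by
  have hre : Tendsto (fun a : ℝ => (a : ℂ)) atTop (comap Complex.re atTop) :=
    tendsto_comap_iff.2 (show Tendsto (fun a : ℝ => (a : ℂ).re) atTop atTop from tendsto_id)
  refine ⟨isWellPosed_of_admissible hT hC hK hτ,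
    hre.eventually (eventually_inResolventSet hT hC hK hτ), fun w => ?_⟩
  have h1 := ((tendsto_transferFunction hT hC hK hτ).comp hre)
  exact ((ContinuousLinearMap.apply ℂ Y w).continuous.tendsto _).comp h1

end StateSystem

end Systems

/-! ### The closed loop as a perturbation of a decoupled system -/

section ClosedLoop

/-- Relative boundedness passes from `C'` to `C = Λ C'` with a bounded `Λ`. -/
theorem IsRelBounded.of_comp {X Y V : Type*} [NormedAddCommGroup X] [NormedSpace ℂ X]
    [NormedAddCommGroup Y] [NormedSpace ℂ Y] [NormedAddCommGroup V] [NormedSpace ℂ V]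
    {T : C0Semigroup X} {C' : X →ₗ.[ℂ] V} {C : X →ₗ.[ℂ] Y} (hC : IsRelBounded T C') (Λ : V →L[ℂ] Y)
    (h : ∀ x ∈ C'.domain, x ∈ C.domain ∧ evalOn C x = Λ (evalOn C' x)) : IsRelBounded T C := by
  refine ⟨fun hx => (h _ (hC.mem hx)).1, ?_⟩
  obtain ⟨M, hM⟩ := hC.bounded
  refine ⟨‖Λ‖ * M, fun x y hx => ?_⟩
  rw [(h _ (hC.mem hx)).2, mul_assoc]
  exact Λ.le_opNorm_of_le (hM x y hx)

theorem AdmissibleOn.of_comp {X Y V : Type*} [NormedAddCommGroup X] [NormedSpace ℂ X]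
    [CompleteSpace X] [NormedAddCommGroup Y] [NormedSpace ℂ Y] [NormedAddCommGroup V]
    [NormedSpace ℂ V] {T : C0Semigroup X} {C' : X →ₗ.[ℂ] V} {C : X →ₗ.[ℂ] Y} {τ K : ℝ}
    (hC : IsRelBounded T C') (hK : AdmissibleOn T C' τ K) (hτ : 0 ≤ τ) (Λ : V →L[ℂ] Y)
    (h : ∀ x ∈ C'.domain, x ∈ C.domain ∧ evalOn C x = Λ (evalOn C' x)) :
    AdmissibleOn T C τ (‖Λ‖ * K) := by
  intro x y hx
  have hc' := hC.continuous_evalOn hx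
  have hc := (hC.of_comp Λ h).continuous_evalOn hx
  calc ∫ s in 0..τ, ‖evalOn C (T.flow s x)‖ ^ 2
      ≤ ∫ s in 0..τ, ‖Λ‖ ^ 2 * ‖evalOn C' (T.flow s x)‖ ^ 2 := by
        refine intervalIntegral.integral_mono_on hτ
          (Continuous.intervalIntegrable (by fun_prop) _ _)
          (Continuous.intervalIntegrable (by fun_prop) _ _) fun s _ => ?_
        rw [(h _ (hC.mem (hx.flow s))).2, ← mul_pow]
        gcongr
        exact Λ.le_opNorm _
    _ ≤ ‖Λ‖ ^ 2 * (K ^ 2 * ‖x‖ ^ 2) := by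
        rw [intervalIntegral.integral_const_mul]
        gcongr
        exact hK x y hx
    _ = _ := by ring

section Augmentation

variable {X Y : Type*} (Z : Type*) [NormedAddCommGroup X] [NormedSpace ℂ X]
  [NormedAddCommGroup Y] [NormedSpace ℂ Y] [NormedAddCommGroup Z] [NormedSpace ℂ Z]

/-- The semigroup `diag(T(t), I)` on `X × Z`. -/
def C0Semigroup.prodId (T : C0Semigroup X) : C0Semigroup (WithLp 2 (X × Z)) where
  op t := ((WithLp.prodContinuousLinearEquiv 2 ℂ X Z).symm : X × Z →L[ℂ] WithLp 2 (X × Z)) ∘L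
    ((T.op t).prodMap (ContinuousLinearMap.id ℂ Z)) ∘L
      (WithLp.prodContinuousLinearEquiv 2 ℂ X Z : WithLp 2 (X × Z) →L[ℂ] X × Z)
  op_zero := by
    rw [T.op_zero]
    rfl
  op_add s t hs ht := by
    rw [T.op_add s t hs ht]
    rfl
  continuousOn_orbit p :=
    (WithLp.prodContinuousLinearEquiv 2 ℂ X Z).symm.continuous.comp_continuousOn
      ((T.continuousOn_orbit p.fst).prodMk continuousOn_const)

theorem C0Semigroup.prodId_hasGen_iff (T : C0Semigroup X) {p r : WithLp 2 (X × Z)} :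
    (T.prodId Z).HasGen p r ↔ T.HasGen p.fst r.fst ∧ r.snd = 0 := by
  constructor
  · intro h
    have h1 := ((WithLp.prodContinuousLinearEquiv 2 ℂ X Z :
      WithLp 2 (X × Z) →L[ℂ] X × Z).restrictScalars ℝ).hasFDerivAt.comp_hasDerivWithinAt (0 : ℝ) h
    refine ⟨(ContinuousLinearMap.fst ℝ X Z).hasFDerivAt.comp_hasDerivWithinAt (0 : ℝ) h1, ?_⟩
    have h2 := (ContinuousLinearMap.snd ℝ X Z).hasFDerivAt.comp_hasDerivWithinAt (0 : ℝ) h1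
    exact (uniqueDiffWithinAt_Ioi 0).eq_deriv _ h2
      (hasDerivWithinAt_const (0 : ℝ) (Ioi (0 : ℝ)) p.snd)
  · rintro ⟨h1, h2⟩
    have h3 := HasDerivWithinAt.prodMk h1 (hasDerivWithinAt_const (0 : ℝ) (Ioi (0 : ℝ)) p.snd)
    have h4 := (((WithLp.prodContinuousLinearEquiv 2 ℂ X Z).symm :
      X × Z →L[ℂ] WithLp 2 (X × Z)).restrictScalars ℝ).hasFDerivAt.comp_hasDerivWithinAt (0 : ℝ) h3
    rw [← h2] at h4
    exact h4

/-- The observation `(x, z) ↦ (C x, z)`. -/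
def augmentedObservation (C : X →ₗ.[ℂ] Y) : WithLp 2 (X × Z) →ₗ.[ℂ] Y × Z where
  domain := C.domain.comap (WithLp.fstₗ 2 ℂ X Z)
  toFun := LinearMap.prod
    (C.toFun ∘ₗ (WithLp.fstₗ 2 ℂ X Z).restrict fun _ h => h)
    (WithLp.sndₗ 2 ℂ X Z ∘ₗ Submodule.subtype _)

variable {Z}

theorem evalOn_augmentedObservation {C : X →ₗ.[ℂ] Y} {p : WithLp 2 (X × Z)}
    (hp : p.fst ∈ C.domain) :
    evalOn (augmentedObservation Z C) p = (evalOn C p.fst, p.snd) := by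
  rw [evalOn_of_mem C hp, evalOn_of_mem (augmentedObservation Z C) (x := p) hp]
  rfl

theorem IsRelBounded.augmented {T : C0Semigroup X} {C : X →ₗ.[ℂ] Y} (hC : IsRelBounded T C) :
    IsRelBounded (T.prodId Z) (augmentedObservation Z C) := by
  refine ⟨fun h => hC.mem ((T.prodId_hasGen_iff Z).1 h).1, ?_⟩
  obtain ⟨M, hM⟩ := hC.bounded
  refine ⟨|M| + 1, fun p r h => ?_⟩
  have h1 := ((T.prodId_hasGen_iff Z).1 h).1
  rw [evalOn_augmentedObservation (hC.mem h1)]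
  have h2 : ‖evalOn C p.fst‖ ≤ |M| * (‖p‖ + ‖r‖) := by
    calc _ ≤ M * (‖p.fst‖ + ‖r.fst‖) := hM _ _ h1
      _ ≤ |M| * (‖p.fst‖ + ‖r.fst‖) := by gcongr; exact le_abs_self M
      _ ≤ _ := by gcongr <;> exact WithLp.norm_fst_le X _
  refine (max_le ?_ ?_ : max ‖evalOn C p.fst‖ ‖p.snd‖ ≤ _)
  · nlinarith [norm_nonneg p, norm_nonneg r]
  · have := WithLp.norm_snd_le X p
    nlinarith [mul_nonneg (abs_nonneg M) (add_nonneg (norm_nonneg p) (norm_nonneg r)),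
      norm_nonneg r]

theorem AdmissibleOn.augmented [CompleteSpace X] {T : C0Semigroup X} {C : X →ₗ.[ℂ] Y} {τ K : ℝ}
    (hC : IsRelBounded T C) (hK : AdmissibleOn T C τ K) (hτ : 0 ≤ τ) :
    AdmissibleOn (T.prodId Z) (augmentedObservation Z C) τ √(K ^ 2 + τ) := by
  intro p r h
  have h1 := ((T.prodId_hasGen_iff Z).1 h).1
  have hc := hC.continuous_evalOn h1
  have e : ∀ s, evalOn (augmentedObservation Z C) ((T.prodId Z).flow s p) =
      (evalOn C (T.flow s p.fst), p.snd) := fun s => by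
    exact evalOn_augmentedObservation (p := WithLp.toLp 2 (T.flow s p.fst, p.snd))
      (hC.mem (h1.flow s))
  simp only [e]
  calc ∫ s in 0..τ, ‖(evalOn C (T.flow s p.fst), p.snd)‖ ^ 2
      ≤ ∫ s in 0..τ, (‖evalOn C (T.flow s p.fst)‖ ^ 2 + ‖p.snd‖ ^ 2) := by
        refine intervalIntegral.integral_mono_on hτ
          (Continuous.intervalIntegrable (by fun_prop) _ _)
          (Continuous.intervalIntegrable (by fun_prop) _ _) fun s _ => ?_
        rw [Prod.norm_mk]
        rcases max_choice ‖evalOn C (T.flow s p.fst)‖ ‖p.snd‖ with h | h <;> rw [h]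
        · linarith [sq_nonneg ‖p.snd‖]
        · linarith [sq_nonneg ‖evalOn C (T.flow s p.fst)‖]
    _ = (∫ s in 0..τ, ‖evalOn C (T.flow s p.fst)‖ ^ 2) + τ * ‖p.snd‖ ^ 2 := by
        rw [intervalIntegral.integral_add (Continuous.intervalIntegrable (by fun_prop) _ _)
          (Continuous.intervalIntegrable (by fun_prop) _ _)]
        simp
    _ ≤ K ^ 2 * ‖p.fst‖ ^ 2 + τ * ‖p.snd‖ ^ 2 := by gcongr; exact hK _ _ h1
    _ ≤ _ := by
        rw [Real.sq_sqrt (by positivity), WithLp.prod_norm_sq_eq_of_L2 p]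
        nlinarith [mul_nonneg hτ (sq_nonneg ‖p.fst‖),
          mul_nonneg (sq_nonneg K) (sq_nonneg ‖p.snd‖)]

end Augmentation

namespace ControlLoop

variable {U X Y Z : Type*} {q : ℕ}
    [NormedAddCommGroup U] [InnerProductSpace ℂ U] [NormedAddCommGroup X] [InnerProductSpace ℂ X]
    [NormedAddCommGroup Y] [InnerProductSpace ℂ Y] [NormedAddCommGroup Z] [InnerProductSpace ℂ Z]
    (P : ControlLoop U X Y Z q) (Bs : P.RightInverse)

/-- The bounded operator `H` with `A_e (x, z) = (A_s x, 0) + H (𝒞 x, z)`. -/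
def perturbation : Y × Z →L[ℂ] WithLp 2 (X × Z) :=
  ((WithLp.prodContinuousLinearEquiv 2 ℂ X Z).symm : X × Z →L[ℂ] WithLp 2 (X × Z)) ∘L
    ((-(P.BRK Bs ∘L P.𝒢₂)).coprod (P.ABRK Bs - P.BRK Bs ∘L P.G₁tilde Bs)).prod
      (P.𝒢₂.coprod (P.G₁tilde Bs))

theorem Ae_apply (p : (P.Ae Bs).domain) {hp : (p : WithLp 2 (X × Z)).fst ∈ P.As.domain} :
    P.Ae Bs p = WithLp.toLp 2 (P.As ⟨(p : WithLp 2 (X × Z)).fst, hp⟩, 0) +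
      P.perturbation Bs (evalOn (augmentedObservation Z P.𝒞) p) := by
  rw [evalOn_augmentedObservation (P.domain_As_le hp), evalOn_of_mem _ (P.domain_As_le hp)]
  have h1 : P.Ae Bs p = WithLp.toLp 2
        (P.As ⟨(p : WithLp 2 (X × Z)).fst, hp⟩
            - P.BRK Bs (P.𝒢₂ (P.𝒞 ⟨(p : WithLp 2 (X × Z)).fst, P.domain_As_le hp⟩))
            + (P.ABRK Bs - P.BRK Bs ∘L P.G₁tilde Bs) (p : WithLp 2 (X × Z)).snd,
          P.𝒢₂ (P.𝒞 ⟨(p : WithLp 2 (X × Z)).fst, P.domain_As_le hp⟩)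
            + P.G₁tilde Bs (p : WithLp 2 (X × Z)).snd) := rfl
  rw [h1]
  apply (WithLp.linearEquiv 2 ℂ (X × Z)).injective
  ext <;> simp [perturbation]
  abel

/-- A semigroup whose generator is `diag(A_s, 0) + H C'` is generated by `A_e`. -/
theorem isGenerator_Ae {Ts : C0Semigroup X} (hTs : Ts.IsGenerator P.As)
    {S : C0Semigroup (WithLp 2 (X × Z))}
    (hS : ∀ p w, S.HasGen p w ↔ ∃ r, (Ts.prodId Z).HasGen p r ∧
      w = r + P.perturbation Bs (evalOn (augmentedObservation Z P.𝒞) p)) :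
    S.IsGenerator (P.Ae Bs) := by
  rw [C0Semigroup.isGenerator_iff]
  intro p w
  rw [hS, LinearPMap.mem_graph_iff]
  constructor
  · rintro ⟨p', rfl, rfl⟩
    have hp : (p' : WithLp 2 (X × Z)).fst ∈ P.As.domain := p'.2.1
    exact ⟨WithLp.toLp 2 (P.As ⟨_, hp⟩, 0), (Ts.prodId_hasGen_iff Z).2
      ⟨hTs.hasGen ⟨_, hp⟩, rfl⟩, P.Ae_apply Bs p'⟩
  · rintro ⟨r, hr, rfl⟩
    obtain ⟨h1, h2⟩ := (Ts.prodId_hasGen_iff Z).1 hr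
    obtain ⟨x, hx1, hx2⟩ := P.As.mem_graph_iff.1 (hTs.mem_graph_iff.2 h1)
    simp only at hx1 hx2
    have hp : p.fst ∈ P.As.domain := hx1 ▸ x.2
    refine ⟨⟨p, hp, trivial⟩, rfl, ?_⟩
    rw [P.Ae_apply Bs ⟨p, hp, trivial⟩ (hp := hp)]
    congr 1
    apply (WithLp.linearEquiv 2 ℂ (X × Z)).injective
    refine Prod.ext ?_ h2.symm
    change P.As ⟨p.fst, hp⟩ = r.fst
    rw [← hx2]
    congr 1
    exact Subtype.ext hx1.symm

theorem evalOn_Ce (p : WithLp 2 (X × Z)) (hp : p ∈ (augmentedObservation Z P.𝒞).domain) :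
    p ∈ (P.Ce Bs).domain ∧ evalOn (P.Ce Bs) p =
      (ContinuousLinearMap.id ℂ Y).coprod (P.CBRK Bs) (evalOn (augmentedObservation Z P.𝒞) p) := by
  have hp1 : p.fst ∈ P.𝒞.domain := hp
  have hp2 : p ∈ (P.Ce Bs).domain := ⟨hp1, trivial⟩
  refine ⟨hp2, ?_⟩
  rw [evalOn_augmentedObservation hp1, evalOn_of_mem _ hp1, evalOn_of_mem _ hp2]
  rfl

end ControlLoop

end ClosedLoop

end BoundaryControl

end

theorem mainTheorem5 {U X Y Z : Type*}
    [NormedAddCommGroup U] [InnerProductSpace ℂ U] [CompleteSpace U]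
    [NormedAddCommGroup X] [InnerProductSpace ℂ X] [CompleteSpace X]
    [NormedAddCommGroup Y] [InnerProductSpace ℂ Y] [CompleteSpace Y]
    [NormedAddCommGroup Z] [InnerProductSpace ℂ Z] [CompleteSpace Z]
    {q : ℕ} (P : BoundaryControl.ControlLoop U X Y Z q)
    (hQ : BoundaryControl.IsAdmissibleFeedback P.ℬ P.𝒜 P.𝒞 (P.R₁ ∘L P.Q))
    (Ts : BoundaryControl.C0Semigroup X) (hTs : Ts.IsGenerator P.As)
    (hC : BoundaryControl.IsAdmissibleObservation Ts P.As P.𝒞)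
    (Bs : P.RightInverse) :
    (∃ Te : BoundaryControl.C0Semigroup (WithLp 2 (X × Z)),
      Te.IsGenerator (P.Ae Bs) ∧
      BoundaryControl.IsAdmissibleObservation Te (P.Ae Bs) (P.Ce Bs)) ∧
    (P.closedLoop Bs).IsWellPosed ∧
    (P.closedLoop Bs).IsRegularWith (P.De Bs) ∧
    (∀ᶠ lam in comap Complex.re atTop, BoundaryControl.InResolventSet (P.Ae Bs) lam) ∧
    Tendsto (fun lam : ℂ =>
        LinearMap.toContinuousLinearMap ((P.closedLoop Bs).transferFunction lam))
      (comap Complex.re atTop) (𝓝 (P.De Bs)) := by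
  obtain ⟨hCs, τ, K, hτ, hK⟩ := (BoundaryControl.isAdmissibleObservation_iff hTs).1 hC
  have hC' := hCs.augmented (Z := Z)
  have hK' := hK.augmented (Z := Z) hCs hτ.le
  obtain ⟨Te, hTe⟩ := hK'.exists_perturbation hC' hτ (P.perturbation Bs)
  have hgen := P.isGenerator_Ae Bs hTs hTe
  obtain ⟨τ', K', hτ', hKS⟩ := hK'.of_perturbation hC' hτ hTe
  have hCS := hC'.of_perturbation hK' hτ hTe
  have hCe := hCS.of_comp _ (P.evalOn_Ce Bs)
  have hKe := hKS.of_comp hCS hτ'.le _ (P.evalOn_Ce Bs)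
  exact ⟨⟨Te, hgen, (BoundaryControl.isAdmissibleObservation_iff hgen).2 ⟨hCe, τ', _, hτ', hKe⟩⟩,
    BoundaryControl.StateSystem.isWellPosed_of_admissible hgen hCe hKe hτ',
    BoundaryControl.StateSystem.isRegularWith_of_admissible hgen hCe hKe hτ',
    BoundaryControl.StateSystem.eventually_inResolventSet (S := P.closedLoop Bs) hgen hCe hKe hτ',
    BoundaryControl.StateSystem.tendsto_transferFunction hgen hCe hKe hτ'⟩
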